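/- Let $0<a\le b\le 2$, let $\alpha:\mathbf{R}\to[a,b]$ be continuous, let $\lambda>0$, $1/a<H<1$ and $u\in\mathbf{R}$. Write $(x)_+=\max\{x,0\}$, with the convention $0^\gamma=0$ for all $\gamma\in\mathbf{R}$. For a measurable $\beta:\mathbf{R}\to[a,b]$, let $\mathcal{F}_\beta$ be the set of measurable $f:\mathbf{R}\to\mathbf{R}$ with $\int_{-\infty}^{\infty}|f(x)/c|^{\beta(x)}dx\le 1$ for some $c>0$. The multistable integrals $\int f\,dM_\beta$, $f\in\mathcal{F}_\beta$, are defined through their finite-dimensional distributions, given by $$\mathbf{E}\Big[e^{i\sum_{k=1}^d\theta_k\int f_k\,dM_\beta}\Big]=\exp\Big\{-\int_{-\infty}^{\infty}\Big|\sum_{k=1}^d\theta_kf_k(x)\Big|^{\beta(x)}dx\Big\},\qquad d\ge 0,\ \theta_k\in\mathbf{R},\ f_k\in\mathcal{F}_\beta ;$$ if $\beta$ is a constant $A$, write $Z_A$ for $M_\beta$ (the symmetric $A$-stable random measure). Let $$X(t)=\int_{-\infty}^{\infty}\Big[e^{-\lambda(t-x)_+}(t-x)_+^{H-\frac1{\alpha(x)}}-e^{-\lambda(-x)_+}(-x)_+^{H-\frac1{\alpha(x)}}\Big]dM_\alpha(x),\qquad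 t\in\mathbf{R},$$ be the linear tempered fractional multistable motion (LTFmSM), and let $$Y(t)=\int_{-\infty}^{\infty}\Big[(t-x)_+^{H-\frac1{\alpha(u)}}-(-x)_+^{H-\frac1{\alpha(u)}}\Big]dZ_{\alpha(u)}(x),\qquad t\in\mathbf{R},$$ be the linear fractional stable motion (LFSM) with constant index $\alpha(u)$. Then $X$ is $H$-strongly localisable at $u$ to $Y$; that is, $Y$ is non-trivial (not almost surely zero at all times), $X$ and $Y$ have versions with continuous paths, and, for these versions, as $r\searrow0$ the processes $$v\mapsto\frac{X(u+rv)-X(u)}{r^H},\qquad v\in\mathbf{R},$$ converge in distribution to $Y$ in the space $C(\mathbf{R})$ of continuous functions with the topology of uniform convergence on bounded intervals. -/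

import Mathlib

open MeasureTheory Filter Topology

noncomputable section

namespace Multistable

/-! ### Multistable stochastic integrals -/

/-- The quasinorm of the variable exponent Lebesgue space `F_α`: the infimum (in `[0, ∞]`) of all
`c > 0` with `∫ |f x / c| ^ α x dx ≤ 1`. For `0 ≠ f` with finite quasinorm and
`α : ℝ → [a, b] ⊂ (0, ∞)` it is the unique `c > 0` with `∫ |f x / c| ^ α x dx = 1`. -/
def quasiNorm (α f : ℝ → ℝ) : ENNReal :=
  ⨅ (c : ℝ) (_ : 0 < c ∧ ∫⁻ x, ENNReal.ofReal (|f x / c| ^ α x) ≤ 1), ENNReal.ofReal c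

/-- The variable exponent Lebesgue space `F_α`. -/
def variableLp (α : ℝ → ℝ) : Set (ℝ → ℝ) :=
  {f | Measurable f ∧ quasiNorm α f < ⊤}

/-- `X t = ∫ f t x dM_α(x)`, `t ∈ T`, where `M_α` is the symmetric independently scattered
`α(x)`-multistable random measure: the multistable integrals of integrands in `F_α` are the random
variables whose finite-dimensional distributions have the characteristic functions
`E exp(i ∑ θ_k ∫ f_k dM_α) = exp(-∫ |∑ θ_k f_k x| ^ α x dx)`.
For a constant function `α` this is the integral with respect to a symmetric `α`-stable random
measure with Lebesgue control measure. -/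
structure IsMultistableIntegral {T Ω : Type*} [MeasurableSpace Ω] (α : ℝ → ℝ)
    (f : T → ℝ → ℝ) (X : T → Ω → ℝ) (P : Measure Ω) : Prop where
  measurable : ∀ t, Measurable (X t)
  charFun : ∀ (d : ℕ) (t : Fin d → T) (θ : Fin d → ℝ), (∀ k, f (t k) ∈ variableLp α) →
    ∫ ω, Complex.exp (Complex.I * ((∑ k, θ k * X (t k) ω : ℝ) : ℂ)) ∂P
      = ((Real.exp (-∫ x, |∑ k, θ k * f (t k) x| ^ α x) : ℝ) : ℂ)

/-! ### The two processes -/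

/-- `(y)_+ ^ γ` with the convention `0 ^ γ = 0` for every real `γ`. -/
def posPow (y γ : ℝ) : ℝ := if 0 < y then y ^ γ else 0

/-- The kernel
`G(t, x) = e^{-lam (t-x)_+} (t-x)_+^{H - 1/α(x)} - e^{-lam (-x)_+} (-x)_+^{H - 1/α(x)}`. -/
def temperedKernel (H : ℝ) (α : ℝ → ℝ) (lam t x : ℝ) : ℝ :=
  Real.exp (-lam * max (t - x) 0) * posPow (t - x) (H - 1 / α x)
    - Real.exp (-lam * max (-x) 0) * posPow (-x) (H - 1 / α x)

/-- The kernel `(t-x)_+^{H - 1/A} - (-x)_+^{H - 1/A}` with constant index `A`. -/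
def fractionalKernel (H A t x : ℝ) : ℝ :=
  posPow (t - x) (H - 1 / A) - posPow (-x) (H - 1 / A)

/-- `X` is a linear tempered fractional multistable motion with parameters `H`, `α(x)`, `lam`. -/
def IsLTFmSM {Ω : Type*} [MeasurableSpace Ω] (H : ℝ) (α : ℝ → ℝ) (lam : ℝ)
    (X : ℝ → Ω → ℝ) (P : Measure Ω) : Prop :=
  IsMultistableIntegral α (temperedKernel H α lam) X P

/-- `Y` is a linear fractional stable motion with parameter `H` and constant stability
index `A`. -/
def IsLFSM {Ω : Type*} [MeasurableSpace Ω] (H A : ℝ)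
    (Y : ℝ → Ω → ℝ) (P : Measure Ω) : Prop :=
  IsMultistableIntegral (fun _ => A) (fractionalKernel H A) Y P

/-! ### Strong localisability -/

/-- `C(ℝ, ℝ)` carries the compact-open topology, i.e. that of uniform convergence on bounded
intervals; we equip it with its Borel σ-algebra. -/
instance instMeasurableSpacePaths : MeasurableSpace C(ℝ, ℝ) := borel _

instance instBorelSpacePaths : BorelSpace C(ℝ, ℝ) := ⟨rfl⟩

/-- The random continuous path `X'` is a version of the process `X`. -/
def IsContinuousVersion {Ω : Type*} [MeasurableSpace Ω] (X' : Ω → C(ℝ, ℝ))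
    (X : ℝ → Ω → ℝ) (P : Measure Ω) : Prop :=
  Measurable X' ∧ ∀ t, ∀ᵐ ω ∂P, X' ω t = X t ω

/-- The rescaled path `v ↦ (g (u + r v) - g u) / r ^ h`. -/
def rescale (h u r : ℝ) (g : C(ℝ, ℝ)) : C(ℝ, ℝ) where
  toFun v := (g (u + r * v) - g u) / r ^ h
  continuous_toFun := by fun_prop

/-- `X` is `h`-strongly localisable at `u` to the process `Y`: `h > 0`, `Y` is non-trivial (not
almost surely zero at all times), `X` and `Y` have versions with continuous paths, and as `r ↘ 0`
the processes `v ↦ (X (u + r v) - X u) / r ^ h` converge to `Y` in distribution on `C(ℝ, ℝ)`, for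
the topology of uniform convergence on bounded intervals. -/
def IsStronglyLocalisableAt {Ω Ω' : Type*} [MeasurableSpace Ω] [MeasurableSpace Ω']
    (h : ℝ) (X : ℝ → Ω → ℝ) (P : Measure Ω) [IsProbabilityMeasure P] (u : ℝ)
    (Y : ℝ → Ω' → ℝ) (Q : Measure Ω') [IsProbabilityMeasure Q] : Prop :=
  0 < h ∧
  (∃ v, ¬ ∀ᵐ ω ∂Q, Y v ω = 0) ∧
  ∃ (X' : Ω → C(ℝ, ℝ)) (Y' : Ω' → C(ℝ, ℝ)),
    IsContinuousVersion X' X P ∧ IsContinuousVersion Y' Y Q ∧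
    TendstoInDistribution (fun (r : ℝ) (ω : Ω) => rescale h u r (X' ω)) (𝓝[>] (0 : ℝ)) Y'
      (fun _ => P) Q

end Multistable

end

/-! Everything is read off characteristic functions. Substituting `x = u - r z` in the exponent for
the increments of `X` from `u`, divided by `r ^ H`, the powers of `r` cancel and leave the same kind
of integral with index `α (u - r z)` and tempering `lam * r`. As `r ↘ 0` these tend to `α u` and
`0`, and dominated convergence gives the exponent for `Y` (`Admissible.tendsto_exponent`). The
domination needs kernel bounds uniform in the tempering and in the index
(`abs_temperedPow_sub_rpow_le`).

The same bounds, put into the truncation inequality for characteristic functions, give `P (|X t - X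
s| > x) ≤ C ((t - s) ^ H / x) ^ a` (`IsLTFmSM.hasIncrementTail`). Since `a * H > 1`, a dyadic
chaining argument with Borel–Cantelli yields continuous versions. The bound is invariant under
rescaling, so dyadic interpolation approximates all rescaled paths uniformly in `r`. This plays the
role of tightness: convergence in distribution on `C(ℝ, ℝ)` reduces to that of the interpolants,
which are continuous functions of finitely many values of the process.

`Y` is itself the case of constant index and tempering `0`, so the results for `X` apply to it. -/

noncomputable section

namespace Multistable

/-! ### Piecewise linear interpolation at dyadic points -/

/-- The hat function `y ↦ (1 - |y|)_+`. -/
def hat (y : ℝ) : ℝ := max 0 (1 - |y|)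

lemma continuous_hat : Continuous hat := by unfold hat; fun_prop

/-- The function with the values of `g` at the points `k / 2 ^ n` of `[-n, n]`, and linear between
them. -/
def interp (n : ℕ) (g : ℝ → ℝ) : C(ℝ, ℝ) where
  toFun x := ∑ j ∈ Finset.range (2 * n * 2 ^ n + 1),
    g (j / 2 ^ n - n) * hat (2 ^ n * (x + n) - j)
  continuous_toFun := by
    have := continuous_hat
    fun_prop

lemma interp_apply (n : ℕ) (g : ℝ → ℝ) {x : ℝ} (hx : |x| < n) :
    interp n g x = (1 - Int.fract (2 ^ n * x)) * g (⌊2 ^ n * x⌋ / 2 ^ n)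
      + Int.fract (2 ^ n * x) * g ((⌊2 ^ n * x⌋ + 1) / 2 ^ n) := by
  have h2 : (0 : ℝ) < 2 ^ n := by positivity
  obtain ⟨hx1, hx2⟩ := abs_lt.1 hx
  set k := ⌊2 ^ n * x⌋ with hk
  set s := Int.fract (2 ^ n * x) with hs
  have hks : 2 ^ n * x = k + s := (Int.floor_add_fract _).symm
  have hs0 : 0 ≤ s := Int.fract_nonneg _
  have hs1 : s < 1 := Int.fract_lt_one _
  have hk0 : -(n * 2 ^ n : ℤ) ≤ k := by
    rw [hk, Int.le_floor]; push_cast; nlinarith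
  have hk1 : k < n * 2 ^ n := by
    rw [hk, Int.floor_lt]; push_cast; nlinarith
  obtain ⟨j, hj⟩ : ∃ j : ℕ, (j : ℤ) = k + n * 2 ^ n := ⟨(k + n * 2 ^ n).toNat, by omega⟩
  have hjR : (j : ℝ) = k + n * 2 ^ n := by exact_mod_cast hj
  -- The strict bound `|x| < n` keeps the right neighbour of `x` among the nodes.
  have hjlt : j + 1 < 2 * n * 2 ^ n + 1 := by
    zify; rw [hj]; linarith
  have e1 : (j : ℝ) / 2 ^ n - n = k / 2 ^ n := by rw [hjR]; field_simp; ring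
  have e2 : ((j + 1 : ℕ) : ℝ) / 2 ^ n - n = (k + 1) / 2 ^ n := by
    push_cast; rw [hjR]; field_simp; ring
  change ∑ j ∈ Finset.range (2 * n * 2 ^ n + 1), g (j / 2 ^ n - n) * hat (2 ^ n * (x + n) - j) = _
  rw [Finset.sum_eq_add j (j + 1) (by omega)]
  · have a1 : 2 ^ n * (x + n) - (j : ℝ) = s := by rw [hjR]; linarith
    have a2 : 2 ^ n * (x + n) - ((j + 1 : ℕ) : ℝ) = s - 1 := by push_cast; linarith
    have b1 : hat s = 1 - s := by
      unfold hat; rw [abs_of_nonneg hs0, max_eq_right (by linarith)]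
    have b2 : hat (s - 1) = s := by
      unfold hat; rw [abs_of_nonpos (by linarith), max_eq_right (by linarith)]; ring
    rw [a1, a2, b1, b2, e1, e2]; ring
  · intro i _ hi
    have : 1 ≤ |2 ^ n * (x + n) - (i : ℝ)| := by
      have e : 2 ^ n * (x + n) = j + s := by rw [hjR]; linarith
      rw [e]
      rcases lt_or_gt_of_ne hi.1 with h | h
      · have : (i : ℝ) + 1 ≤ j := by exact_mod_cast h
        exact le_abs.2 (Or.inl (by linarith))
      · have : j + 1 < i := lt_of_le_of_ne h (Ne.symm hi.2)
        have : (j : ℝ) + 1 + 1 ≤ i := by exact_mod_cast this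
        exact le_abs.2 (Or.inr (by linarith))
    unfold hat
    rw [max_eq_left (by linarith), mul_zero]
  · intro h; simp at h; omega
  · intro h; simp at h; omega

/-- The interpolant at `x` is a convex combination of the two neighbouring node values. -/
lemma abs_interp_sub_le (n : ℕ) (g : ℝ → ℝ) {x c ε : ℝ} (hx : |x| < n)
    (h0 : |g (⌊2 ^ n * x⌋ / 2 ^ n) - c| ≤ ε) (h1 : |g ((⌊2 ^ n * x⌋ + 1) / 2 ^ n) - c| ≤ ε) :
    |interp n g x - c| ≤ ε := by
  rw [interp_apply n g hx]
  have hs0 := Int.fract_nonneg (2 ^ n * x)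
  have hs1 := (Int.fract_lt_one (2 ^ n * x)).le
  generalize Int.fract (2 ^ n * x) = s at *
  rw [abs_le] at *
  constructor <;> nlinarith

/-- The increments of `g` between adjacent points `k / 2 ^ n` of `[-n, n]` are at most `q ^ n`. -/
def DyadicIncrementsLE (q : ℝ) (n : ℕ) (g : ℝ → ℝ) : Prop :=
  ∀ k ∈ Finset.Icc (-(n * 2 ^ n : ℤ)) (n * 2 ^ n),
    |g ((k + 1) / 2 ^ n) - g (k / 2 ^ n)| ≤ q ^ n

lemma DyadicIncrementsLE.abs_interp_succ_sub_le {q : ℝ} {n : ℕ} {g : ℝ → ℝ}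
    (h : DyadicIncrementsLE q (n + 1) g) {x : ℝ} (hx : |x| < n) :
    |interp (n + 1) g x - interp n g x| ≤ 2 * q ^ (n + 1) := by
  have h2 : (0 : ℝ) < 2 ^ n := by positivity
  obtain ⟨hx1, hx2⟩ := abs_lt.1 hx
  set k := ⌊2 ^ n * x⌋ with hk
  have hk0 : -(n * 2 ^ n : ℤ) ≤ k := by
    rw [hk, Int.le_floor]; push_cast; nlinarith
  have hk1 : k < n * 2 ^ n := by
    rw [hk, Int.floor_lt]; push_cast; nlinarith
  have hpow : (1 : ℤ) ≤ 2 ^ n := one_le_pow₀ (by norm_num)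
  have hexp : ((n + 1 : ℕ) : ℤ) * 2 ^ (n + 1) = 2 * (n * 2 ^ n) + 2 * 2 ^ n := by
    push_cast; ring
  have m0 := h (2 * k) (by rw [Finset.mem_Icc, hexp]; constructor <;> linarith)
  have m1 := h (2 * k + 1) (by rw [Finset.mem_Icc, hexp]; constructor <;> linarith)
  have e0 : ((2 * k : ℤ) : ℝ) / 2 ^ (n + 1) = k / 2 ^ n := by
    push_cast; rw [pow_succ]; field_simp
  have e2 : (((2 * k + 1 : ℤ) : ℝ) + 1) / 2 ^ (n + 1) = (k + 1) / 2 ^ n := by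
    push_cast; rw [pow_succ]; field_simp; ring
  have e1 : (((2 * k : ℤ) : ℝ) + 1) / 2 ^ (n + 1) = ((2 * k + 1 : ℤ) : ℝ) / 2 ^ (n + 1) := by
    push_cast; ring
  rw [e0, e1] at m0
  rw [e2] at m1
  -- `c` is the value at the midpoint of the level-`n` cell containing `x`. It is a node of level `n
  -- + 1`, so each interpolant is within one fine increment of it.
  set c := g (((2 * k + 1 : ℤ) : ℝ) / 2 ^ (n + 1)) with hc
  have hq : 0 ≤ q ^ (n + 1) := (abs_nonneg _).trans m1
  have c1 : |interp n g x - c| ≤ q ^ (n + 1) :=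
    abs_interp_sub_le n g hx (by rwa [abs_sub_comm]) m1
  have c2 : |interp (n + 1) g x - c| ≤ q ^ (n + 1) := by
    have hx' : |x| < (n + 1 : ℕ) := by push_cast; linarith
    have hfl := Int.floor_le (2 ^ n * x)
    have hfl' := Int.lt_floor_add_one (2 ^ n * x)
    rw [← hk] at hfl hfl'
    rcases lt_or_ge (2 ^ (n + 1) * x) (2 * k + 1) with hlt | hge
    · have hk' : ⌊2 ^ (n + 1) * x⌋ = 2 * k := by
        rw [Int.floor_eq_iff]; push_cast
        exact ⟨by rw [pow_succ]; linarith, hlt⟩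
      refine abs_interp_sub_le (n + 1) g hx' ?_ ?_
      · rw [hk', e0, abs_sub_comm]; exact m0
      · rw [hk', e1, ← hc]; simpa using hq
    · have hk' : ⌊2 ^ (n + 1) * x⌋ = 2 * k + 1 := by
        rw [Int.floor_eq_iff]; push_cast
        exact ⟨hge, by rw [pow_succ]; linarith⟩
      refine abs_interp_sub_le (n + 1) g hx' ?_ ?_
      · rw [hk', ← hc]; simpa using hq
      · rw [hk', e2]; exact m1
  calc _ = |(interp (n + 1) g x - c) - (interp n g x - c)| := by ring_nf
    _ ≤ _ := abs_sub _ _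
    _ ≤ _ := by linarith

lemma abs_interp_sub_interp_le {q : ℝ} (hq0 : 0 < q) (hq1 : q < 1) {m n : ℕ} {g : ℝ → ℝ}
    (h : ∀ j, m < j → DyadicIncrementsLE q j g) (hmn : m ≤ n) {x : ℝ} (hx : |x| < m) :
    |interp n g x - interp m g x| ≤ 2 * q ^ m / (1 - q) := by
  -- The right-hand side is the geometric sum of `2 * q ^ j` over `m < j ≤ m + i`.
  have key : ∀ i : ℕ, |interp (m + i) g x - interp m g x| ≤
      2 * q ^ m * (q - q ^ (i + 1)) / (1 - q) := by
    intro i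
    have h1q : 0 < 1 - q := by linarith
    induction i with
    | zero => simp
    | succ i ih =>
      have hstep := (h (m + i + 1) (by omega)).abs_interp_succ_sub_le (x := x)
        (hx.trans_le (by exact_mod_cast Nat.le_add_right m i))
      calc _ ≤ |interp (m + i + 1) g x - interp (m + i) g x|
            + |interp (m + i) g x - interp m g x| := abs_sub_le _ _ _
        _ ≤ 2 * q ^ (m + i + 1) + 2 * q ^ m * (q - q ^ (i + 1)) / (1 - q) := add_le_add hstep ih
        _ = _ := by field_simp; ring
  obtain ⟨i, rfl⟩ := Nat.exists_eq_add_of_le hmn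
  refine (key i).trans ?_
  have h1q : 0 < 1 - q := by linarith
  have : 0 < q ^ (i + 1) := by positivity
  refine div_le_div_of_nonneg_right ?_ h1q.le
  nlinarith [pow_pos hq0 m]

lemma tendsto_floor_div_two_pow (x : ℝ) :
    Tendsto (fun n : ℕ => (⌊2 ^ n * x⌋ : ℝ) / 2 ^ n) atTop (𝓝 x) ∧
    Tendsto (fun n : ℕ => ((⌊2 ^ n * x⌋ : ℝ) + 1) / 2 ^ n) atTop (𝓝 x) := by
  have h0 : Tendsto (fun n : ℕ => (1 / 2 : ℝ) ^ n) atTop (𝓝 0) :=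
    tendsto_pow_atTop_nhds_zero_of_lt_one (by norm_num) (by norm_num)
  have hb : ∀ n : ℕ, x - (1 / 2) ^ n ≤ (⌊2 ^ n * x⌋ : ℝ) / 2 ^ n ∧
      (⌊2 ^ n * x⌋ : ℝ) / 2 ^ n ≤ x := by
    intro n
    have h2 : (0 : ℝ) < 2 ^ n := by positivity
    rw [le_div_iff₀ h2, div_le_iff₀ h2, sub_mul, ← mul_pow]
    norm_num
    constructor
    · linarith [Int.lt_floor_add_one (2 ^ n * x)]
    · linarith [Int.floor_le (2 ^ n * x)]
  have A : Tendsto (fun n : ℕ => (⌊2 ^ n * x⌋ : ℝ) / 2 ^ n) atTop (𝓝 x) :=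
    tendsto_of_tendsto_of_tendsto_of_le_of_le (by simpa using tendsto_const_nhds.sub h0)
      tendsto_const_nhds (fun n => (hb n).1) (fun n => (hb n).2)
  refine ⟨A, ?_⟩
  have := A.add h0
  rw [add_zero] at this
  refine this.congr fun n => ?_
  rw [one_div_pow, add_div]

lemma tendsto_interp_of_tendsto {g : ℝ → ℝ} {x c : ℝ}
    (h0 : Tendsto (fun n : ℕ => g (⌊2 ^ n * x⌋ / 2 ^ n)) atTop (𝓝 c))
    (h1 : Tendsto (fun n : ℕ => g ((⌊2 ^ n * x⌋ + 1) / 2 ^ n)) atTop (𝓝 c)) :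
    Tendsto (fun n => interp n g x) atTop (𝓝 c) := by
  rw [Metric.tendsto_atTop] at *
  intro ε hε
  obtain ⟨N0, hN0⟩ := h0 (ε / 2) (by positivity)
  obtain ⟨N1, hN1⟩ := h1 (ε / 2) (by positivity)
  obtain ⟨N2, hN2⟩ := exists_nat_gt |x|
  refine ⟨max N0 (max N1 N2), fun n hn => ?_⟩
  simp only [max_le_iff] at hn
  refine lt_of_le_of_lt (b := ε / 2) ?_ (by linarith)
  refine abs_interp_sub_le n g (hN2.trans_le (by exact_mod_cast hn.2.2)) ?_ ?_
  · exact (hN0 n hn.1).le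
  · exact (hN1 n hn.2.1).le

lemma tendsto_interp_of_continuousAt {g : ℝ → ℝ} {x : ℝ} (hg : ContinuousAt g x) :
    Tendsto (fun n => interp n g x) atTop (𝓝 (g x)) :=
  tendsto_interp_of_tendsto (hg.tendsto.comp (tendsto_floor_div_two_pow x).1)
    (hg.tendsto.comp (tendsto_floor_div_two_pow x).2)

lemma abs_sub_interp_le {q : ℝ} (hq0 : 0 < q) (hq1 : q < 1) {m : ℕ} {g : ℝ → ℝ}
    (hg : Continuous g) (h : ∀ j, m < j → DyadicIncrementsLE q j g) {x : ℝ} (hx : |x| < m) :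
    |g x - interp m g x| ≤ 2 * q ^ m / (1 - q) := by
  refine le_of_tendsto (((tendsto_interp_of_continuousAt hg.continuousAt).sub_const _).abs) ?_
  filter_upwards [eventually_ge_atTop m] with n hn
  exact abs_interp_sub_interp_le hq0 hq1 h hn hx

lemma exists_forall_abs_lt_of_mem_uniformity {U : Set (C(ℝ, ℝ) × C(ℝ, ℝ))}
    (hU : U ∈ uniformity C(ℝ, ℝ)) : ∃ (N : ℕ) (η : ℝ), 0 < η ∧
      ∀ f g : C(ℝ, ℝ), (∀ x : ℝ, |x| < N → |f x - g x| < η) → (f, g) ∈ U := by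
  rw [ContinuousMap.mem_compactConvergence_entourage_iff] at hU
  obtain ⟨K, V, hK, hV, hKV⟩ := hU
  obtain ⟨η, hη, hηV⟩ := Metric.mem_uniformity_dist.1 hV
  obtain ⟨R, hR⟩ := hK.isBounded.exists_norm_le
  obtain ⟨N, hN⟩ := exists_nat_gt R
  exact ⟨N, η, hη, fun f g h => hKV fun x hx => hηV (h x ((hR x hx).trans_lt hN))⟩

lemma exists_tendsto_interp {q : ℝ} (hq0 : 0 < q) (hq1 : q < 1) {m : ℕ} {g : ℝ → ℝ}
    (h : ∀ j, m < j → DyadicIncrementsLE q j g) :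
    ∃ G : C(ℝ, ℝ), Tendsto (fun n => interp n g) atTop (𝓝 G) := by
  refine cauchySeq_tendsto_of_complete (cauchySeq_iff.2 fun U hU => ?_)
  obtain ⟨N, η, hη, hNU⟩ := exists_forall_abs_lt_of_mem_uniformity hU
  have h0 : Tendsto (fun n : ℕ => 2 * (2 * q ^ n / (1 - q))) atTop (𝓝 0) := by
    simpa using (((tendsto_pow_atTop_nhds_zero_of_lt_one hq0.le hq1).const_mul 2).div_const
      (1 - q)).const_mul 2
  obtain ⟨M, hM, hMm, hMN⟩ := ((h0.eventually_lt_const hη).and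
    ((eventually_ge_atTop m).and (eventually_ge_atTop N))).exists
  refine ⟨M, fun k hk l hl => hNU _ _ fun x hx => ?_⟩
  have hx' : |x| < M := hx.trans_le (by exact_mod_cast hMN)
  have a1 := abs_interp_sub_interp_le hq0 hq1 (fun j hj => h j (hMm.trans_lt hj)) hk hx'
  have a2 := abs_interp_sub_interp_le hq0 hq1 (fun j hj => h j (hMm.trans_lt hj)) hl hx'
  calc _ = |(interp k g x - interp M g x) - (interp l g x - interp M g x)| := by ring_nf
    _ ≤ _ := abs_sub _ _
    _ < _ := by linarith

/-! ### Continuous versions of processes with small increments -/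

section

variable {Ω : Type*} [MeasurableSpace Ω]

/-- The weak moment bound `P (|X t - X s| > x) ≤ C ((t - s) ^ H / x) ^ a` on the increments of the
process `X`. -/
def HasIncrementTail (C H a : ℝ) (X : ℝ → Ω → ℝ) (P : Measure Ω) : Prop :=
  ∀ s t x, s < t → 0 < x → P.real {ω | x < |X t ω - X s ω|} ≤ C * ((t - s) ^ H / x) ^ a

lemma HasIncrementTail.le_of_abs_sub_le {C H a : ℝ} {X : ℝ → Ω → ℝ} {P : Measure Ω}
    (hC : 0 ≤ C) (hH : 0 < H) (ha : 0 < a) (hX : HasIncrementTail C H a X P) {s t x δ : ℝ}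
    (hst : |t - s| ≤ δ) (hx : 0 < x) :
    P.real {ω | x < |X t ω - X s ω|} ≤ C * (δ ^ H / x) ^ a := by
  have hδ : 0 ≤ δ := (abs_nonneg _).trans hst
  rcases lt_trichotomy s t with h | rfl | h
  · rw [abs_of_pos (by linarith)] at hst
    refine (hX s t x h hx).trans ?_
    have : 0 < t - s := by linarith
    gcongr
  · have : {ω | x < |X s ω - X s ω|} = ∅ := by ext; simp [hx.le]
    rw [this]; simp; positivity
  · rw [abs_of_neg (by linarith)] at hst
    have : 0 < s - t := by linarith
    simp_rw [abs_sub_comm (X t _)]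
    refine (hX t s x h hx).trans ?_
    gcongr
    linarith

lemma HasIncrementTail.congr {C H a : ℝ} {X X' : ℝ → Ω → ℝ} {P : Measure Ω}
    (hX : HasIncrementTail C H a X P) (h : ∀ t, ∀ᵐ ω ∂P, X' t ω = X t ω) :
    HasIncrementTail C H a X' P := by
  intro s t x hst hx
  refine le_trans (le_of_eq ?_) (hX s t x hst hx)
  refine measureReal_congr ?_
  filter_upwards [h s, h t] with ω h1 h2
  change (x < |X' t ω - X' s ω|) = (x < |X t ω - X s ω|)
  rw [h1, h2]

/-- A bound for the probability that `DyadicIncrementsLE q n` fails. -/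
def dyadicTail (C H a q : ℝ) (n : ℕ) : ℝ :=
  3 * C * ((n + 1) * (2 * ((1 / 2) ^ H / q) ^ a) ^ n)

/-- At level `n` there are about `n * 2 ^ n` increments, each exceeding `q ^ n` with probability of
order `((1 / 2) ^ H / q) ^ (a * n)`. Summability thus needs `q > (1 / 2) ^ (H - 1 / a)`; halving the
exponent leaves room below `1` because `a * H > 1`. -/
lemma exists_ratio {H a : ℝ} (ha : 0 < a) (haH : 1 < a * H) :
    ∃ q : ℝ, 0 < q ∧ q < 1 ∧ 2 * ((1 / 2) ^ H / q) ^ a < 1 := by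
  have hδ : 0 < (H - 1 / a) / 2 := by
    have : 1 / a < H := by rw [div_lt_iff₀ ha]; linarith
    linarith
  refine ⟨(1 / 2 : ℝ) ^ ((H - 1 / a) / 2), by positivity,
    Real.rpow_lt_one (by norm_num) (by norm_num) hδ, ?_⟩
  rw [← Real.rpow_sub (by norm_num), ← Real.rpow_mul (by norm_num)]
  have : (1 / 2 : ℝ) ^ ((H - (H - 1 / a) / 2) * a) < (1 / 2 : ℝ) ^ (1 : ℝ) := by
    refine Real.rpow_lt_rpow_of_exponent_gt (by norm_num) (by norm_num) ?_
    field_simp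
    linarith
  rw [Real.rpow_one] at this
  linarith

lemma summable_dyadicTail {C H a q : ℝ} (hq : 0 < q) (h : 2 * ((1 / 2) ^ H / q) ^ a < 1) :
    Summable (dyadicTail C H a q) := by
  have h0 : 0 ≤ 2 * ((1 / 2) ^ H / q) ^ a := by positivity
  have hn : ‖2 * ((1 / 2) ^ H / q) ^ a‖ < 1 := by rwa [Real.norm_of_nonneg h0]
  refine Summable.mul_left _ ?_
  have h1 := summable_pow_mul_geometric_of_norm_lt_one 1 hn
  have h2 := summable_geometric_of_norm_lt_one hn
  refine (h1.add h2).congr fun n => ?_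
  simp; ring

lemma scale_pow {H a q : ℝ} (hq : 0 < q) (n : ℕ) :
    ((((1 / 2 : ℝ) ^ n) ^ H) / q ^ n) ^ a = (((1 / 2) ^ H / q) ^ a) ^ n := by
  rw [Real.rpow_pow_comm (by positivity), div_pow ((1 / 2 : ℝ) ^ H) q, Real.rpow_pow_comm (by positivity)]

/-- A wasteful bound for a single increment, chosen so that one summable sequence serves every use
of Borel–Cantelli. -/
lemma HasIncrementTail.measureReal_le_dyadicTail {C H a q : ℝ} {X : ℝ → Ω → ℝ} {P : Measure Ω}
    (hC : 0 ≤ C) (hH : 0 < H) (ha : 0 < a) (hq : 0 < q) (hX : HasIncrementTail C H a X P)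
    {s t : ℝ} {n : ℕ} (hst : |t - s| ≤ (1 / 2) ^ n) :
    P.real {ω | q ^ n < |X t ω - X s ω|} ≤ dyadicTail C H a q n := by
  refine (hX.le_of_abs_sub_le hC hH ha hst (pow_pos hq n)).trans ?_
  rw [scale_pow hq, dyadicTail, mul_pow]
  have h2 : (1 : ℝ) ≤ 2 ^ n := one_le_pow₀ (by norm_num)
  have h3 : 0 ≤ C * (((1 / 2) ^ H / q) ^ a) ^ n := by positivity
  have h4 : (1 : ℝ) ≤ 3 * ((n + 1) * 2 ^ n) := by
    have : (0 : ℝ) ≤ n := n.cast_nonneg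
    nlinarith
  calc _ ≤ C * (((1 / 2) ^ H / q) ^ a) ^ n * (3 * ((n + 1) * 2 ^ n)) := le_mul_of_one_le_right h3 h4
    _ = _ := by ring

lemma setOf_not_dyadicIncrementsLE {Ω : Type*} (q : ℝ) (n : ℕ) (X : ℝ → Ω → ℝ) :
    {ω | ¬ DyadicIncrementsLE q n (fun t => X t ω)} =
      ⋃ k ∈ Finset.Icc (-(n * 2 ^ n : ℤ)) (n * 2 ^ n),
        {ω | q ^ n < |X ((k + 1) / 2 ^ n) ω - X (k / 2 ^ n) ω|} := by
  ext ω
  simp only [DyadicIncrementsLE, Set.mem_ofPred_eq, Set.mem_iUnion, not_forall, not_le, exists_prop]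

lemma measurableSet_not_dyadicIncrementsLE (q : ℝ) (n : ℕ) {X : ℝ → Ω → ℝ}
    (hX : ∀ t, Measurable (X t)) :
    MeasurableSet {ω | ¬ DyadicIncrementsLE q n (fun t => X t ω)} := by
  rw [setOf_not_dyadicIncrementsLE]
  refine Finset.measurableSet_biUnion _ fun k _ => ?_
  exact measurableSet_lt measurable_const (((hX _).sub (hX _)).abs)

/-- A union bound over `2 * n * 2 ^ n + 1 ≤ 3 * (n + 1) * 2 ^ n` adjacent pairs. -/
lemma HasIncrementTail.measureReal_not_dyadicIncrementsLE_le {C H a q : ℝ} {X : ℝ → Ω → ℝ}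
    {P : Measure Ω} [IsFiniteMeasure P]
    (hC : 0 ≤ C) (hH : 0 < H) (ha : 0 < a) (hq : 0 < q) (hX : HasIncrementTail C H a X P)
    (n : ℕ) :
    P.real {ω | ¬ DyadicIncrementsLE q n (fun t => X t ω)} ≤ dyadicTail C H a q n := by
  rw [setOf_not_dyadicIncrementsLE]
  refine (measureReal_biUnion_finset_le _ _).trans ?_
  have hk : ∀ k ∈ Finset.Icc (-(n * 2 ^ n : ℤ)) (n * 2 ^ n),
      P.real {ω | q ^ n < |X ((k + 1) / 2 ^ n) ω - X (k / 2 ^ n) ω|} ≤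
        C * (((1 / 2) ^ H / q) ^ a) ^ n := by
    intro k _
    rw [← scale_pow hq]
    refine hX.le_of_abs_sub_le hC hH ha (le_of_eq ?_) (pow_pos hq n)
    rw [← sub_div, add_sub_cancel_left, abs_of_pos (by positivity), one_div_pow]
  refine (Finset.sum_le_card_nsmul _ _ _ hk).trans ?_
  rw [nsmul_eq_mul, Int.card_Icc, dyadicTail, mul_pow]
  have hcard : (((n * 2 ^ n + 1 - -(n * 2 ^ n) : ℤ).toNat : ℕ) : ℝ) = 2 * (n * 2 ^ n) + 1 := by
    have : (n * 2 ^ n + 1 - -(n * 2 ^ n) : ℤ).toNat = 2 * (n * 2 ^ n) + 1 := by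
      zify
      rw [Int.toNat_of_nonneg (by linarith [show (0 : ℤ) ≤ n * 2 ^ n by positivity])]; ring
    rw [this]; push_cast; ring
  rw [hcard]
  have h2 : (1 : ℝ) ≤ 2 ^ n := one_le_pow₀ (by norm_num)
  have h3 : 0 ≤ C * (((1 / 2) ^ H / q) ^ a) ^ n := by positivity
  have h4 : 2 * ((n : ℝ) * 2 ^ n) + 1 ≤ 3 * ((n + 1) * 2 ^ n) := by
    have : (0 : ℝ) ≤ n := n.cast_nonneg
    nlinarith
  calc _ ≤ (3 * ((n + 1) * 2 ^ n)) * (C * (((1 / 2) ^ H / q) ^ a) ^ n) := by gcongr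
    _ = _ := by ring

lemma ae_eventually_notMem_of_summable {P : Measure Ω} [IsFiniteMeasure P] {s : ℕ → Set Ω}
    {b : ℕ → ℝ} (hb : Summable b) (h : ∀ n, P.real (s n) ≤ b n) :
    ∀ᵐ ω ∂P, ∀ᶠ n in atTop, ω ∉ s n := by
  refine ae_eventually_notMem (ne_top_of_le_ne_top hb.tsum_ofReal_ne_top ?_)
  refine ENNReal.tsum_le_tsum fun n => ?_
  rw [← ofReal_measureReal]
  exact ENNReal.ofReal_le_ofReal (h n)

/-- The interpolation as a function of the values at the nodes. -/
def nodeInterp (n : ℕ) (c : EuclideanSpace ℝ (Fin (2 * n * 2 ^ n + 1))) : C(ℝ, ℝ) where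
  toFun x := ∑ j, c j * hat (2 ^ n * (x + n) - j)
  continuous_toFun := by
    have := continuous_hat
    fun_prop

lemma continuous_nodeInterp (n : ℕ) : Continuous (nodeInterp n) := by
  refine ContinuousMap.continuous_of_continuous_uncurry _ ?_
  have := continuous_hat
  simp only [nodeInterp, ContinuousMap.coe_mk, Function.uncurry_def]
  fun_prop

/-- The values of `g` at the nodes of the interpolation. -/
def nodeValues (n : ℕ) (g : ℝ → ℝ) : EuclideanSpace ℝ (Fin (2 * n * 2 ^ n + 1)) :=
  WithLp.toLp 2 fun j => g (j / 2 ^ n - n)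

/-- Factoring through a Euclidean space gives measurability of the random interpolant, and later
lets the continuous mapping theorem reduce its convergence to finite-dimensional distributions. -/
lemma interp_eq_nodeInterp (n : ℕ) (g : ℝ → ℝ) : interp n g = nodeInterp n (nodeValues n g) := by
  ext x
  simp only [interp, nodeInterp, nodeValues, ContinuousMap.coe_mk]
  rw [Finset.sum_range]

lemma measurable_nodeValues (n : ℕ) {X : ℝ → Ω → ℝ} (hX : ∀ t, Measurable (X t)) :
    Measurable fun ω => nodeValues n fun t => X t ω :=
  (WithLp.measurable_toLp 2 _).comp (measurable_pi_lambda _ fun _ => hX _)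

lemma measurable_interp (n : ℕ) {X : ℝ → Ω → ℝ} (hX : ∀ t, Measurable (X t)) :
    Measurable fun ω => interp n fun t => X t ω := by
  simp_rw [interp_eq_nodeInterp]
  exact (continuous_nodeInterp n).measurable.comp (measurable_nodeValues n hX)

/-- A weak-moment form of the Kolmogorov continuity theorem. -/
theorem HasIncrementTail.exists_isContinuousVersion {C H a : ℝ} {X : ℝ → Ω → ℝ}
    {P : Measure Ω} [IsProbabilityMeasure P]
    (hC : 0 ≤ C) (hH : 0 < H) (ha : 0 < a) (haH : 1 < a * H) (hXm : ∀ t, Measurable (X t))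
    (hX : HasIncrementTail C H a X P) :
    ∃ X' : Ω → C(ℝ, ℝ), IsContinuousVersion X' X P := by
  obtain ⟨q, hq0, hq1, hq⟩ := exists_ratio ha haH
  have hsum := summable_dyadicTail (C := C) hq0 hq
  have hconv : ∀ᵐ ω ∂P, ∃ G : C(ℝ, ℝ),
      Tendsto (fun n => interp n fun t => X t ω) atTop (𝓝 G) := by
    filter_upwards [ae_eventually_notMem_of_summable hsum
      (hX.measureReal_not_dyadicIncrementsLE_le hC hH ha hq0)] with ω hω
    obtain ⟨m, hm⟩ := eventually_atTop.1 hω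
    exact exists_tendsto_interp hq0 hq1 (m := m) fun j hj => not_not.1 (hm j hj.le)
  obtain ⟨X', hX'm, hX'⟩ := measurable_limit_of_tendsto_metrizable_ae
    (fun n => (measurable_interp n hXm).aemeasurable) hconv
  refine ⟨X', hX'm, fun t => ?_⟩
  -- Both dyadic neighbours of `t` are within `2 ^ (-n)` of it, so by Borel–Cantelli `X` at these
  -- points tends to `X t` almost surely. The null set may depend on `t`, which is all that a
  -- version requires.
  have hfl : ∀ n : ℕ, |(⌊2 ^ n * t⌋ : ℝ) / 2 ^ n - t| ≤ (1 / 2) ^ n ∧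
      |((⌊2 ^ n * t⌋ : ℝ) + 1) / 2 ^ n - t| ≤ (1 / 2) ^ n := by
    intro n
    have h2 : (0 : ℝ) < 2 ^ n := by positivity
    have e1 : (⌊2 ^ n * t⌋ : ℝ) / 2 ^ n - t = (⌊2 ^ n * t⌋ - 2 ^ n * t) / 2 ^ n := by field_simp
    have e2 : ((⌊2 ^ n * t⌋ : ℝ) + 1) / 2 ^ n - t = (⌊2 ^ n * t⌋ + 1 - 2 ^ n * t) / 2 ^ n := by
      field_simp
    rw [e1, e2, abs_div, abs_div, abs_of_pos h2, one_div_pow]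
    constructor <;> gcongr <;> rw [abs_le] <;>
      constructor <;> linarith [Int.floor_le (2 ^ n * t), Int.lt_floor_add_one (2 ^ n * t)]
  have hq_lim : Tendsto (fun n : ℕ => q ^ n) atTop (𝓝 0) :=
    tendsto_pow_atTop_nhds_zero_of_lt_one hq0.le hq1
  filter_upwards [hX', ae_eventually_notMem_of_summable hsum fun n =>
      hX.measureReal_le_dyadicTail hC hH ha hq0 (hfl n).1,
    ae_eventually_notMem_of_summable hsum fun n =>
      hX.measureReal_le_dyadicTail hC hH ha hq0 (hfl n).2] with ω h0 h1 h2
  have t1 : Tendsto (fun n => interp n (fun t => X t ω) t) atTop (𝓝 (X' ω t)) :=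
    ((continuous_eval_const t).tendsto _).comp h0
  refine tendsto_nhds_unique t1 (tendsto_interp_of_tendsto ?_ ?_)
  · rw [tendsto_iff_dist_tendsto_zero]
    refine squeeze_zero' (Eventually.of_forall fun _ => dist_nonneg) ?_ hq_lim
    filter_upwards [h1] with n hn
    exact not_lt.1 hn
  · rw [tendsto_iff_dist_tendsto_zero]
    refine squeeze_zero' (Eventually.of_forall fun _ => dist_nonneg) ?_ hq_lim
    filter_upwards [h2] with n hn
    exact not_lt.1 hn

end

/-! ### Convergence in distribution of continuous processes -/

lemma integrable_comp_of_forall_dist_le {Ω E : Type*} [MeasurableSpace Ω] [MeasurableSpace E]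
    {P : Measure Ω} [IsProbabilityMeasure P] {F : E → ℝ} (hF : Measurable F) {M : ℝ}
    (hM : ∀ x y, dist (F x) (F y) ≤ M) {T : Ω → E} (hT : Measurable T) :
    Integrable (fun ω => F (T ω)) P := by
  have : Nonempty Ω := P.nonempty_of_neZero
  let x₀ := T (Classical.arbitrary Ω)
  refine Integrable.of_bound (hF.comp hT).aestronglyMeasurable (‖F x₀‖ + M)
    (ae_of_all _ fun a => ?_)
  rw [← sub_le_iff_le_add']
  exact (abs_sub_abs_le_abs_sub (F (T a)) (F x₀)).trans (hM _ _)

lemma abs_integral_sub_integral_le {Ω E : Type*} [MeasurableSpace Ω] [MeasurableSpace E]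
    (P : Measure Ω) [IsProbabilityMeasure P] {F : E → ℝ} (hF : Measurable F) {M : ℝ}
    (hM : ∀ x y, dist (F x) (F y) ≤ M) {S T : Ω → E} (hS : Measurable S) (hT : Measurable T)
    {η δ : ℝ} {B : Set Ω} (hη : 0 ≤ η) (hB : MeasurableSet B) (hBδ : P.real B ≤ δ)
    (hd : ∀ ω ∉ B, dist (F (S ω)) (F (T ω)) < η) :
    |∫ ω, F (S ω) ∂P - ∫ ω, F (T ω) ∂P| ≤ η + |M| * δ := by
  have hSi := integrable_comp_of_forall_dist_le (P := P) hF hM hS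
  have hTi := integrable_comp_of_forall_dist_le (P := P) hF hM hT
  rw [← integral_sub hSi hTi]
  have hint : Integrable (fun ω => η + B.indicator (fun _ => |M|) ω) P :=
    (integrable_const _).add ((integrable_const _).indicator hB)
  calc |∫ ω, (F (S ω) - F (T ω)) ∂P| ≤ ∫ ω, |F (S ω) - F (T ω)| ∂P :=
        abs_integral_le_integral_abs
    _ ≤ ∫ ω, (η + B.indicator (fun _ => |M|) ω) ∂P := by
        refine integral_mono (hSi.sub hTi).abs hint fun ω => ?_
        by_cases hω : ω ∈ B
        · simp only [Set.indicator_of_mem hω]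
          have := (hM (S ω) (T ω)).trans (le_abs_self M)
          rw [Real.dist_eq] at this
          linarith
        · simp only [Set.indicator_of_notMem hω, add_zero]
          exact (hd ω hω).le
    _ = η + P.real B * |M| := by
        rw [integral_add (integrable_const _) ((integrable_const _).indicator hB),
          integral_indicator_const _ hB]
        simp
    _ ≤ _ := by nlinarith [abs_nonneg M]

lemma integral_map_of_measurable {Ω E : Type*} [MeasurableSpace Ω] [MeasurableSpace E]
    (P : Measure Ω) {F : E → ℝ} (hF : Measurable F) {T : Ω → E} (hT : Measurable T) :
    ∫ x, F x ∂(P.map T) = ∫ ω, F (T ω) ∂P :=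
  integral_map hT.aemeasurable hF.aestronglyMeasurable

/-- Approximation criterion for convergence in distribution. -/
theorem tendstoInDistribution_of_approx {ι Ω Ω' E : Type*} {l : Filter ι} [l.IsCountablyGenerated]
    [MeasurableSpace Ω] [MeasurableSpace Ω'] {P : Measure Ω} [IsProbabilityMeasure P]
    {Q : Measure Ω'} [IsProbabilityMeasure Q] [UniformSpace E]
    [(uniformity E).IsCountablyGenerated] [MeasurableSpace E] [BorelSpace E]
    {Z : ι → Ω → E} {W : ℕ → ι → Ω → E} {Y : Ω' → E} {V : ℕ → Ω' → E}
    (hZ : ∀ i, Measurable (Z i)) (hW : ∀ n i, Measurable (W n i)) (hY : Measurable Y)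
    (hV : ∀ n, Measurable (V n))
    (h : ∀ n, TendstoInDistribution (W n) l (V n) (fun _ => P) Q)
    (hZW : ∀ U ∈ uniformity E, ∀ δ > 0, ∀ᶠ n in atTop, ∀ᶠ i in l, ∃ B, MeasurableSet B ∧
      P.real B ≤ δ ∧ ∀ ω ∉ B, (Z i ω, W n i ω) ∈ U)
    (hYV : ∀ U ∈ uniformity E, ∀ δ > 0, ∀ᶠ n in atTop, ∃ B, MeasurableSet B ∧
      Q.real B ≤ δ ∧ ∀ ω ∉ B, (Y ω, V n ω) ∈ U) :
    TendstoInDistribution Z l Y (fun _ => P) Q := by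
  -- A countably generated uniformity comes from a pseudometric, so bounded Lipschitz test functions
  -- suffice.
  let := UniformSpace.pseudoMetricSpace E
  refine ⟨fun i => (hZ i).aemeasurable, hY.aemeasurable,
    tendsto_iff_forall_lipschitz_integral_tendsto.2 ?_⟩
  rintro F ⟨M, hM⟩ ⟨L, hL⟩
  have hFm : Measurable F := hL.continuous.measurable
  simp only [ProbabilityMeasure.coe_mk, integral_map_of_measurable _ hFm (hZ _),
    integral_map_of_measurable _ hFm hY]
  rw [Metric.tendsto_nhds]
  intro ε hε
  -- Each of the two approximation errors is then at most `ε / 8 + ε / 8`; with `ε / 4` from the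
  -- convergence at fixed `n` the total is below `ε`.
  set δ := ε / (8 * (|M| + 1)) with hδ
  have hδ0 : 0 < δ := by positivity
  have hMδ : |M| * δ ≤ ε / 8 := by
    rw [hδ, mul_div_assoc', div_le_div_iff₀ (by positivity) (by norm_num)]
    nlinarith [abs_nonneg M]
  have hU : {p : E × E | dist (F p.1) (F p.2) < ε / 8} ∈ uniformity E :=
    hL.uniformContinuous (Metric.dist_mem_uniformity (by positivity))
  obtain ⟨n, h1, B', hB', hB'δ, hB'd⟩ := ((hZW _ hU δ hδ0).and (hYV _ hU δ hδ0)).exists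
  have h3 := tendsto_iff_forall_lipschitz_integral_tendsto.1 (h n).tendsto F ⟨M, hM⟩ ⟨L, hL⟩
  simp only [ProbabilityMeasure.coe_mk, integral_map_of_measurable _ hFm (hW n _),
    integral_map_of_measurable _ hFm (hV n)] at h3
  rw [Metric.tendsto_nhds] at h3
  filter_upwards [h1, h3 (ε / 4) (by positivity)] with i ⟨B, hB, hBδ, hBd⟩ hi
  have k1 := abs_integral_sub_integral_le P hFm hM (hZ i) (hW n i) (η := ε / 8) (by positivity) hB hBδ hBd
  have k2 := abs_integral_sub_integral_le Q hFm hM hY (hV n) (η := ε / 8) (by positivity) hB' hB'δ hB'd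
  rw [Real.dist_eq] at *
  rw [abs_le] at k1 k2
  rw [abs_lt] at *
  constructor <;> linarith

/-! ### Finite-dimensional convergence via characteristic functions -/

lemma charFun_map_euclidean {Ω : Type*} [MeasurableSpace Ω] (P : Measure Ω) {d : ℕ}
    {T : Ω → EuclideanSpace ℝ (Fin d)} (hT : Measurable T) (θ : EuclideanSpace ℝ (Fin d)) :
    charFun (P.map T) θ =
      ∫ ω, Complex.exp (Complex.I * ((∑ k, θ k * T ω k : ℝ) : ℂ)) ∂P := by
  rw [charFun_apply, integral_map hT.aemeasurable (by fun_prop)]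
  refine integral_congr_ae (ae_of_all _ fun ω => ?_)
  simp only [PiLp.inner_apply, RCLike.inner_apply, conj_trivial]
  rw [mul_comm]

theorem tendstoInDistribution_euclidean_of_charFun {ι Ω Ω' : Type*} {l : Filter ι}
    [l.IsCountablyGenerated] [MeasurableSpace Ω] [MeasurableSpace Ω'] {P : Measure Ω}
    [IsProbabilityMeasure P] {Q : Measure Ω'} [IsProbabilityMeasure Q] {d : ℕ}
    {Z : ι → Ω → EuclideanSpace ℝ (Fin d)} {Y : Ω' → EuclideanSpace ℝ (Fin d)}
    (hZ : ∀ i, Measurable (Z i)) (hY : Measurable Y)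
    (h : ∀ θ : Fin d → ℝ, Tendsto
      (fun i => ∫ ω, Complex.exp (Complex.I * ((∑ k, θ k * Z i ω k : ℝ) : ℂ)) ∂P) l
      (𝓝 (∫ ω, Complex.exp (Complex.I * ((∑ k, θ k * Y ω k : ℝ) : ℂ)) ∂Q))) :
    TendstoInDistribution Z l Y (fun _ => P) Q := by
  refine ⟨fun i => (hZ i).aemeasurable, hY.aemeasurable, ?_⟩
  -- Lévy's continuity theorem is applied along sequences, hence the countably generated filter.
  refine tendsto_of_seq_tendsto fun s hs => ?_
  refine ProbabilityMeasure.tendsto_of_tendsto_charFun fun θ => ?_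
  simp only [ProbabilityMeasure.coe_mk, Function.comp, charFun_map_euclidean _ (hZ _),
    charFun_map_euclidean _ hY]
  exact (h θ).comp hs

/-- The threshold for `n` depends only on `C`, `H`, `a`, `U` and `δ`, not on the process or its
probability space. This uniformity replaces tightness. -/
lemma exists_uniform_interp_bound {C H a : ℝ} (hC : 0 ≤ C) (hH : 0 < H) (ha : 0 < a)
    (haH : 1 < a * H) {U : Set (C(ℝ, ℝ) × C(ℝ, ℝ))} (hU : U ∈ uniformity C(ℝ, ℝ)) {δ : ℝ}
    (hδ : 0 < δ) :
    ∀ᶠ n in atTop, ∀ {Ω : Type*} [MeasurableSpace Ω] (P : Measure Ω) [IsProbabilityMeasure P]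
      (Z : Ω → C(ℝ, ℝ)), Measurable Z → HasIncrementTail C H a (fun t ω => Z ω t) P →
      ∃ B, MeasurableSet B ∧ P.real B ≤ δ ∧ ∀ ω ∉ B, (Z ω, interp n (Z ω)) ∈ U := by
  obtain ⟨q, hq0, hq1, hq⟩ := exists_ratio ha haH
  have hsum := summable_dyadicTail (C := C) hq0 hq
  have hnn : ∀ n, 0 ≤ dyadicTail C H a q n := fun n => by unfold dyadicTail; positivity
  obtain ⟨N, η, hη, hNU⟩ := exists_forall_abs_lt_of_mem_uniformity hU
  have h0 : Tendsto (fun n : ℕ => 2 * q ^ n / (1 - q)) atTop (𝓝 0) := by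
    simpa using ((tendsto_pow_atTop_nhds_zero_of_lt_one hq0.le hq1).const_mul 2).div_const (1 - q)
  have htail := tendsto_sum_nat_add (dyadicTail C H a q)
  filter_upwards [h0.eventually_lt_const hη, eventually_ge_atTop N,
    htail.eventually_lt_const hδ] with n hn hnN hnδ
  intro Ω _ P _ Z hZ hZt
  have hZm : ∀ t, Measurable fun ω => Z ω t := fun t => by
    exact (continuous_eval_const t).measurable.comp hZ
  refine ⟨⋃ k : ℕ, {ω | ¬ DyadicIncrementsLE q (k + n) (Z ω)}, ?_, ?_, ?_⟩
  · exact MeasurableSet.iUnion fun k => measurableSet_not_dyadicIncrementsLE q (k + n) hZm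
  · refine le_trans ?_ hnδ.le
    have hs' : Summable fun k => dyadicTail C H a q (k + n) := (summable_nat_add_iff n).2 hsum
    rw [measureReal_def]
    refine ENNReal.toReal_le_of_le_ofReal (tsum_nonneg fun k => hnn _) ?_
    refine (measure_iUnion_le _).trans ?_
    rw [ENNReal.ofReal_tsum_of_nonneg (fun k => hnn _) hs']
    refine ENNReal.tsum_le_tsum fun k => ?_
    rw [← ofReal_measureReal]
    exact ENNReal.ofReal_le_ofReal
      (hZt.measureReal_not_dyadicIncrementsLE_le hC hH ha hq0 (k + n))
  · intro ω hω
    simp only [Set.mem_iUnion, Set.mem_ofPred_eq, not_exists, not_not] at hω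
    refine hNU _ _ fun x hx => ?_
    refine (abs_sub_interp_le hq0 hq1 (Z ω).continuous (fun j hj => ?_)
      (hx.trans_le (by exact_mod_cast hnN))).trans_lt hn
    have := hω (j - n)
    rwa [Nat.sub_add_cancel hj.le] at this

/-- Convergence of the finite-dimensional distributions and a uniform bound on the increments imply
convergence in distribution on `C(ℝ, ℝ)`. -/
theorem tendstoInDistribution_of_hasIncrementTail {ι Ω Ω' : Type*} {l : Filter ι}
    [l.IsCountablyGenerated] [MeasurableSpace Ω] [MeasurableSpace Ω'] {P : Measure Ω}
    [IsProbabilityMeasure P] {Q : Measure Ω'} [IsProbabilityMeasure Q]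
    {Z : ι → Ω → C(ℝ, ℝ)} {Y : Ω' → C(ℝ, ℝ)} (hZ : ∀ i, Measurable (Z i)) (hY : Measurable Y)
    {C H a : ℝ} (hC : 0 ≤ C) (hH : 0 < H) (ha : 0 < a) (haH : 1 < a * H)
    (hZt : ∀ᶠ i in l, HasIncrementTail C H a (fun t ω => Z i ω t) P)
    (hYt : HasIncrementTail C H a (fun t ω => Y ω t) Q)
    (h : ∀ (d : ℕ) (t θ : Fin d → ℝ), Tendsto
      (fun i => ∫ ω, Complex.exp (Complex.I * ((∑ k, θ k * Z i ω (t k) : ℝ) : ℂ)) ∂P) l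
      (𝓝 (∫ ω, Complex.exp (Complex.I * ((∑ k, θ k * Y ω (t k) : ℝ) : ℂ)) ∂Q))) :
    TendstoInDistribution Z l Y (fun _ => P) Q := by
  have hZm : ∀ i t, Measurable fun ω => Z i ω t := fun i t =>
    (continuous_eval_const t).measurable.comp (hZ i)
  have hYm : ∀ t, Measurable fun ω => Y ω t := fun t =>
    (continuous_eval_const t).measurable.comp hY
  refine tendstoInDistribution_of_approx (W := fun n i ω => interp n (Z i ω))
    (V := fun n ω => interp n (Y ω)) hZ (fun n i => measurable_interp n (hZm i)) hY
    (fun n => measurable_interp n hYm) (fun n => ?_) (fun U hU δ hδ => ?_) (fun U hU δ hδ => ?_)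
  · simp_rw [interp_eq_nodeInterp]
    refine TendstoInDistribution.continuous_comp (continuous_nodeInterp n) ?_
    refine tendstoInDistribution_euclidean_of_charFun (fun i => measurable_nodeValues n (hZm i))
      (measurable_nodeValues n hYm) fun θ => ?_
    exact h _ (fun j => (j : ℝ) / 2 ^ n - n) θ
  · filter_upwards [exists_uniform_interp_bound hC hH ha haH hU hδ] with n hn
    filter_upwards [hZt] with i hi
    exact hn P (Z i) (hZ i) hi
  · filter_upwards [exists_uniform_interp_bound hC hH ha haH hU hδ] with n hn
    exact hn Q Y hY hYt

/-! ### The tempered power function -/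

/-- The tempered power `e^{-μ y_+} (y)_+ ^ β`. -/
def temperedPow (μ β y : ℝ) : ℝ := Real.exp (-μ * max y 0) * posPow y β

lemma temperedKernel_eq (H : ℝ) (α : ℝ → ℝ) (lam t x : ℝ) :
    temperedKernel H α lam t x =
      temperedPow lam (H - 1 / α x) (t - x) - temperedPow lam (H - 1 / α x) (-x) := rfl

lemma temperedPow_of_nonpos (μ β : ℝ) {y : ℝ} (hy : y ≤ 0) : temperedPow μ β y = 0 := by
  simp [temperedPow, posPow, not_lt.2 hy]

lemma temperedPow_of_pos (μ β : ℝ) {y : ℝ} (hy : 0 < y) :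
    temperedPow μ β y = Real.exp (-μ * y) * y ^ β := by
  simp [temperedPow, posPow, hy, hy.le]

lemma temperedPow_nonneg (μ β y : ℝ) : 0 ≤ temperedPow μ β y := by
  rcases le_or_gt y 0 with hy | hy
  · rw [temperedPow_of_nonpos _ _ hy]
  · rw [temperedPow_of_pos _ _ hy]; positivity

/-- Self-similarity up to a change of tempering: zooming in by `r` turns `μ` into `μ * r`, which
vanishes in the limit. -/
lemma temperedPow_mul (μ β y : ℝ) {r : ℝ} (hr : 0 < r) :
    temperedPow μ β (r * y) = r ^ β * temperedPow (μ * r) β y := by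
  rcases le_or_gt y 0 with hy | hy
  · rw [temperedPow_of_nonpos _ _ hy, temperedPow_of_nonpos _ _ (by nlinarith), mul_zero]
  · rw [temperedPow_of_pos _ _ hy, temperedPow_of_pos _ _ (by positivity),
      Real.mul_rpow hr.le hy.le]
    ring_nf

lemma temperedPow_le_two {μ β y : ℝ} (hμ : 0 ≤ μ) (hβ0 : 0 ≤ β) (hβ1 : β ≤ 1) (hy : y ≤ 2) :
    temperedPow μ β y ≤ 2 := by
  rcases le_or_gt y 0 with hy0 | hy0
  · rw [temperedPow_of_nonpos _ _ hy0]; norm_num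
  · rw [temperedPow_of_pos _ _ hy0]
    have h1 : Real.exp (-μ * y) ≤ 1 := Real.exp_le_one_iff.2 (by nlinarith)
    have h2 : y ^ β ≤ 2 := by
      calc y ^ β ≤ 2 ^ β := Real.rpow_le_rpow hy0.le hy hβ0
        _ ≤ 2 ^ (1 : ℝ) := Real.rpow_le_rpow_of_exponent_le (by norm_num) hβ1
        _ = 2 := by norm_num
    calc Real.exp (-μ * y) * y ^ β ≤ 1 * 2 := mul_le_mul h1 h2 (by positivity) (by norm_num)
      _ = 2 := by norm_num

/-- The bound is free of `μ`. Upwards, Bernoulli's inequality controls the growth of the power;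
downwards, the loss in the exponential is at most `μ * exp (-μ * z) * z ^ β`, and `μ * z * exp (-μ *
z) ≤ 1`. -/
lemma abs_temperedPow_sub_le {μ β z : ℝ} (hμ : 0 ≤ μ) (hβ0 : 0 ≤ β) (hβ1 : β ≤ 1) (hz : 1 < z) :
    |temperedPow μ β (1 + z) - temperedPow μ β z| ≤ z ^ (β - 1) := by
  have hz0 : 0 < z := by linarith
  rw [temperedPow_of_pos _ _ hz0, temperedPow_of_pos _ _ (by linarith)]
  have hzβ : z ^ β = z * z ^ (β - 1) := by
    rw [Real.rpow_sub_one hz0.ne']; field_simp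
  have hw : 0 < z ^ (β - 1) := by positivity
  have hinc : (1 + z) ^ β ≤ z ^ β + z ^ (β - 1) := by
    have hB := rpow_one_add_le_one_add_mul_self (s := 1 / z) (p := β)
      (by have : 0 < 1 / z := by positivity
          linarith) hβ0 hβ1
    have e : 1 + z = z * (1 + 1 / z) := by field_simp; ring
    rw [e, Real.mul_rpow hz0.le (by positivity)]
    calc _ ≤ z ^ β * (1 + β * (1 / z)) := by gcongr
      _ = z ^ β + β * z ^ (β - 1) := by rw [hzβ]; field_simp
      _ ≤ _ := by nlinarith
  have hmono : z ^ β ≤ (1 + z) ^ β := Real.rpow_le_rpow hz0.le (by linarith) hβ0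
  have he1 : Real.exp (-μ * (1 + z)) ≤ 1 := Real.exp_le_one_iff.2 (by nlinarith)
  have he0 : 0 < Real.exp (-μ * (1 + z)) := Real.exp_pos _
  have hez : 0 < Real.exp (-μ * z) := Real.exp_pos _
  have hsplit : Real.exp (-μ * (1 + z)) = Real.exp (-μ * z) * Real.exp (-μ) := by
    rw [← Real.exp_add]; ring_nf
  have hmu : 1 - μ ≤ Real.exp (-μ) := by linarith [Real.add_one_le_exp (-μ)]
  have hle : Real.exp (-μ * (1 + z)) ≤ Real.exp (-μ * z) :=
    Real.exp_le_exp.2 (by nlinarith)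
  have hmuz : μ * z * Real.exp (-μ * z) ≤ 1 := by
    have h1 := Real.add_one_le_exp (μ * z)
    have h2 : Real.exp (μ * z) * Real.exp (-μ * z) = 1 := by
      rw [← Real.exp_add]; simp
    nlinarith
  rw [abs_le]
  constructor
  · have h1 : Real.exp (-μ * z) * (1 - μ) ≤ Real.exp (-μ * (1 + z)) := by
      rw [hsplit]; gcongr
    have h2 : Real.exp (-μ * (1 + z)) * z ^ β ≤ Real.exp (-μ * (1 + z)) * (1 + z) ^ β := by
      gcongr
    have h3 : 0 < z ^ β := by positivity
    have h4 : Real.exp (-μ * z) * μ * z ^ β ≤ z ^ (β - 1) := by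
      rw [hzβ]
      calc _ = (μ * z * Real.exp (-μ * z)) * z ^ (β - 1) := by ring
        _ ≤ 1 * z ^ (β - 1) := by gcongr
        _ = _ := one_mul _
    nlinarith
  · have h1 : Real.exp (-μ * (1 + z)) * (1 + z) ^ β ≤
        Real.exp (-μ * (1 + z)) * (z ^ β + z ^ (β - 1)) := by gcongr
    have h2 : Real.exp (-μ * (1 + z)) * z ^ β ≤ Real.exp (-μ * z) * z ^ β := by gcongr
    nlinarith

/-- An integrable function that dominates the increments of tempered powers. -/
def incrementBound (c z : ℝ) : ℝ :=
  (Set.Ioc (-1) 1).indicator (fun _ => (4 : ℝ)) z + (Set.Ioi 1).indicator (fun z => z ^ (-1 - c)) z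

lemma incrementBound_nonneg (c z : ℝ) : 0 ≤ incrementBound c z := by
  refine add_nonneg (Set.indicator_nonneg (fun _ _ => by norm_num) _)
    (Set.indicator_nonneg (fun x hx => ?_) _)
  exact Real.rpow_nonneg (zero_le_one.trans (le_of_lt hx)) _

lemma integrable_incrementBound {c : ℝ} (hc : 0 < c) : Integrable (incrementBound c) := by
  refine Integrable.add ?_ ?_
  · rw [integrable_indicator_iff measurableSet_Ioc]
    exact integrableOn_const (by simp) (by simp)
  · rw [integrable_indicator_iff measurableSet_Ioi]
    exact integrableOn_Ioi_rpow_of_lt (by linarith) one_pos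

lemma exponent_mem {a A H : ℝ} (ha : 0 < a) (haA : a ≤ A) (hH1 : 1 / a < H) (hH2 : H < 1) :
    0 < H - 1 / A ∧ H - 1 / A ≤ 1 := by
  have h1 : 1 / A ≤ 1 / a := one_div_le_one_div_of_le ha haA
  have h2 : 0 < 1 / A := by have := ha.trans_le haA; positivity
  constructor <;> linarith

lemma one_lt_of_one_div_lt {a H : ℝ} (ha : 0 < a) (hH1 : 1 / a < H) (hH2 : H < 1) : 1 < a := by
  have := hH1.trans hH2
  rwa [div_lt_one ha] at this

/-- For `z ≤ -1` both terms vanish; on `(-1, 1]` both lie in `[0, 2]` and `2 ^ A ≤ 4`; for `z > 1`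
the exponent is `(H - 1 / A - 1) * A = -1 - A * (1 - H) ≤ -1 - a * (1 - H)`. The resulting bound
depends neither on `A` nor on `μ`, and `H < 1` makes it integrable. -/
lemma abs_temperedPow_sub_rpow_le {a A H μ : ℝ} (ha : 0 < a) (haA : a ≤ A) (hA : A ≤ 2)
    (hH1 : 1 / a < H) (hH2 : H < 1) (hμ : 0 ≤ μ) (z : ℝ) :
    |temperedPow μ (H - 1 / A) (1 + z) - temperedPow μ (H - 1 / A) z| ^ A ≤
      incrementBound (a * (1 - H)) z := by
  obtain ⟨hβ0, hβ1⟩ := exponent_mem ha haA hH1 hH2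
  have hA0 : 0 < A := ha.trans_le haA
  rcases le_or_gt z (-1) with hz | hz
  · rw [temperedPow_of_nonpos _ _ (by linarith), temperedPow_of_nonpos _ _ (by linarith)]
    simp [hA0.ne', incrementBound_nonneg]
  rcases le_or_gt z 1 with hz1 | hz1
  · have h1 := temperedPow_le_two hμ hβ0.le hβ1 (y := 1 + z) (by linarith)
    have h2 := temperedPow_le_two hμ hβ0.le hβ1 (y := z) (by linarith)
    have h3 := temperedPow_nonneg μ (H - 1 / A) (1 + z)
    have h4 := temperedPow_nonneg μ (H - 1 / A) z
    have h5 : |temperedPow μ (H - 1 / A) (1 + z) - temperedPow μ (H - 1 / A) z| ≤ 2 :=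
      abs_le.2 ⟨by linarith, by linarith⟩
    have e : incrementBound (a * (1 - H)) z = 4 := by
      simp [incrementBound, hz, hz1]
    rw [e]
    calc _ ≤ (2 : ℝ) ^ A := Real.rpow_le_rpow (abs_nonneg _) h5 hA0.le
      _ ≤ 2 ^ (2 : ℝ) := Real.rpow_le_rpow_of_exponent_le (by norm_num) hA
      _ = 4 := by norm_num
  · have e : incrementBound (a * (1 - H)) z = z ^ (-1 - a * (1 - H)) := by
      simp [incrementBound, hz1]
    rw [e]
    calc _ ≤ (z ^ (H - 1 / A - 1)) ^ A := Real.rpow_le_rpow (abs_nonneg _)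
            (abs_temperedPow_sub_le hμ hβ0.le hβ1 hz1) hA0.le
      _ = z ^ ((H - 1 / A - 1) * A) := by rw [← Real.rpow_mul (by linarith)]
      _ ≤ _ := by
        refine Real.rpow_le_rpow_of_exponent_le hz1.le ?_
        have : (H - 1 / A - 1) * A = -1 - A * (1 - H) := by field_simp; ring
        rw [this]
        nlinarith

lemma abs_temperedPow_sub_rpow_le_scaled {a A H μ h : ℝ} (ha : 0 < a) (haA : a ≤ A) (hA : A ≤ 2)
    (hH1 : 1 / a < H) (hH2 : H < 1) (hμ : 0 ≤ μ) (hh : 0 < h) (z : ℝ) :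
    |temperedPow μ (H - 1 / A) (h + z) - temperedPow μ (H - 1 / A) z| ^ A ≤
      max 1 h ^ (2 : ℝ) * incrementBound (a * (1 - H)) (z / h) := by
  have hA0 : 0 < A := ha.trans_le haA
  obtain ⟨hβ0, hβ1⟩ := exponent_mem ha haA hH1 hH2
  have e1 : h + z = h * (1 + z / h) := by field_simp
  have e2 : temperedPow μ (H - 1 / A) z = temperedPow μ (H - 1 / A) (h * (z / h)) := by
    congr 1; field_simp
  rw [e1, e2, temperedPow_mul _ _ _ hh, temperedPow_mul _ _ _ hh, ← mul_sub, abs_mul,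
    Real.mul_rpow (abs_nonneg _) (abs_nonneg _), abs_of_pos (by positivity)]
  gcongr
  · rw [← Real.rpow_mul hh.le]
    calc _ ≤ max 1 h ^ ((H - 1 / A) * A) :=
          Real.rpow_le_rpow hh.le (le_max_right _ _) (by positivity)
      _ ≤ _ := Real.rpow_le_rpow_of_exponent_le (le_max_left _ _) (by nlinarith)
  · exact abs_temperedPow_sub_rpow_le ha haA hA hH1 hH2 (by positivity) _

lemma exists_integrable_increment_bound {a H : ℝ} (ha : 0 < a) (hH1 : 1 / a < H) (hH2 : H < 1)
    (v : ℝ) : ∃ B : ℝ → ℝ, Integrable B ∧ ∀ μ A z, 0 ≤ μ → a ≤ A → A ≤ 2 →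
      |temperedPow μ (H - 1 / A) (v + z) - temperedPow μ (H - 1 / A) z| ^ A ≤ B z := by
  have hc : 0 < a * (1 - H) := mul_pos ha (by linarith)
  have hint := integrable_incrementBound hc
  rcases lt_trichotomy v 0 with hv | rfl | hv
  -- For `v < 0` the increment is, up to sign, one of step `-v` based at `v + z`.
  · refine ⟨fun z => max 1 (-v) ^ (2 : ℝ) * incrementBound (a * (1 - H)) ((v + z) / (-v)), ?_, ?_⟩
    · exact ((hint.comp_div (neg_ne_zero.2 hv.ne)).comp_add_left v).const_mul _
    · intro μ A z hμ haA hA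
      rw [abs_sub_comm]
      convert abs_temperedPow_sub_rpow_le_scaled ha haA hA hH1 hH2 hμ (neg_pos.2 hv) (v + z)
        using 5
      ring
  · refine ⟨0, integrable_zero _ _ _, fun μ A z _ haA _ => ?_⟩
    simp [(ha.trans_le haA).ne']
  · refine ⟨fun z => max 1 v ^ (2 : ℝ) * incrementBound (a * (1 - H)) (z / v), ?_, ?_⟩
    · exact (hint.comp_div hv.ne').const_mul _
    · intro μ A z hμ haA hA
      exact abs_temperedPow_sub_rpow_le_scaled ha haA hA hH1 hH2 hμ hv z

/-- The constants are made independent of `A`, because `A` becomes `α (u - r * z)` under the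
integral. -/
lemma abs_sum_rpow_le {d : ℕ} (θ x : Fin d → ℝ) {A : ℝ} (hA1 : 1 ≤ A) (hA2 : A ≤ 2) :
    |∑ k, θ k * x k| ^ A ≤ d * ∑ k, max 1 |θ k| ^ (2 : ℝ) * |x k| ^ A := by
  have hA0 : 0 < A := by linarith
  calc |∑ k, θ k * x k| ^ A ≤ (∑ k, |θ k * x k|) ^ A :=
        Real.rpow_le_rpow (abs_nonneg _) (Finset.abs_sum_le_sum_abs _ _) hA0.le
    _ ≤ ((Finset.univ : Finset (Fin d)).card : ℝ) ^ (A - 1) * ∑ k, |θ k * x k| ^ A :=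
        Real.rpow_sum_le_const_mul_sum_rpow _ _ hA1
    _ ≤ _ := by
        rcases Nat.eq_zero_or_pos d with rfl | hd
        · simp
        rw [Finset.card_univ, Fintype.card_fin]
        have hd1 : (1 : ℝ) ≤ d := by exact_mod_cast hd
        gcongr with k _
        · calc (d : ℝ) ^ (A - 1) ≤ (d : ℝ) ^ (1 : ℝ) :=
                Real.rpow_le_rpow_of_exponent_le hd1 (by linarith)
            _ = d := Real.rpow_one _
        · rw [abs_mul, Real.mul_rpow (abs_nonneg _) (abs_nonneg _)]
          gcongr
          calc |θ k| ^ A ≤ max 1 |θ k| ^ A :=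
                Real.rpow_le_rpow (abs_nonneg _) (le_max_right _ _) hA0.le
            _ ≤ _ := Real.rpow_le_rpow_of_exponent_le (le_max_left _ _) hA2

/-! ### Measurability and membership in the variable exponent space -/

lemma measurable_temperedPow : Measurable fun p : ℝ × ℝ × ℝ => temperedPow p.1 p.2.1 p.2.2 := by
  unfold temperedPow posPow
  refine Measurable.mul (by fun_prop) (Measurable.ite ?_ (by fun_prop) measurable_const)
  exact measurableSet_lt measurable_const (by fun_prop)

lemma Measurable.temperedPow {X : Type*} [MeasurableSpace X] {f g h : X → ℝ} (hf : Measurable f)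
    (hg : Measurable g) (hh : Measurable h) :
    Measurable fun x => Multistable.temperedPow (f x) (g x) (h x) :=
  measurable_temperedPow.comp (hf.prodMk (hg.prodMk hh))

lemma measurable_temperedKernel (H : ℝ) {α : ℝ → ℝ} (hα : Measurable α) (lam t : ℝ) :
    Measurable (temperedKernel H α lam t) := by
  simp only [funext (temperedKernel_eq H α lam t)]
  exact (Measurable.temperedPow (by fun_prop) (by fun_prop) (by fun_prop)).sub
    (Measurable.temperedPow (by fun_prop) (by fun_prop) (by fun_prop))

/-- With `c ≥ 1` and `c ^ a = max 1 S`, division by `c` reduces `|f x| ^ α x` by a factor of at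
least `c ^ a ≥ S`. -/
lemma mem_variableLp_of_integrable {a : ℝ} (ha : 0 < a) {α f B : ℝ → ℝ} (hα : ∀ x, a ≤ α x)
    (hf : Measurable f) (hB : Integrable B) (hfB : ∀ x, |f x| ^ α x ≤ B x) :
    f ∈ variableLp α := by
  refine ⟨hf, ?_⟩
  have hB0 : ∀ x, 0 ≤ B x := fun x => (by positivity : 0 ≤ |f x| ^ α x).trans (hfB x)
  set S := ∫ x, B x with hS
  have hS0 : 0 ≤ S := integral_nonneg hB0
  set c := (max 1 S) ^ (1 / a) with hc
  have hm : 1 ≤ max 1 S := le_max_left _ _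
  have hc1 : 1 ≤ c := Real.one_le_rpow hm (by positivity)
  have hc0 : 0 < c := by linarith
  have hca : c ^ a = max 1 S := by
    rw [hc, ← Real.rpow_mul (by linarith), one_div_mul_cancel ha.ne', Real.rpow_one]
  have hle : ∫⁻ x, ENNReal.ofReal (|f x / c| ^ α x) ≤ 1 := by
    calc ∫⁻ x, ENNReal.ofReal (|f x / c| ^ α x)
        ≤ ∫⁻ x, ENNReal.ofReal (B x / max 1 S) := by
          refine lintegral_mono fun x => ENNReal.ofReal_le_ofReal ?_
          rw [abs_div, abs_of_pos hc0, Real.div_rpow (abs_nonneg _) hc0.le]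
          refine div_le_div₀ (hB0 x) (hfB x) (by linarith) ?_
          rw [← hca]
          exact Real.rpow_le_rpow_of_exponent_le hc1 (hα x)
      _ = ENNReal.ofReal (∫ x, B x / max 1 S) := by
          rw [ofReal_integral_eq_lintegral_ofReal (hB.div_const _)
            (ae_of_all _ fun x => div_nonneg (hB0 x) (by linarith))]
      _ ≤ 1 := by
          rw [integral_div, ← hS]
          refine ENNReal.ofReal_le_one.2 ?_
          rw [div_le_one (by linarith)]
          exact le_max_right _ _
  calc quasiNorm α f ≤ ENNReal.ofReal c := iInf₂_le c ⟨hc0, hle⟩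
    _ < ⊤ := ENNReal.ofReal_lt_top

/-- Standing assumptions on the parameters of the two processes. -/
structure Admissible (a H : ℝ) (α : ℝ → ℝ) : Prop where
  pos : 0 < a
  one_div_lt : 1 / a < H
  lt_one : H < 1
  mem_Icc : ∀ x, α x ∈ Set.Icc a 2
  measurable : Measurable α

lemma Admissible.temperedKernel_mem_variableLp {a H lam : ℝ} {α : ℝ → ℝ} (h : Admissible a H α)
    (hlam : 0 ≤ lam) (t : ℝ) : temperedKernel H α lam t ∈ variableLp α := by
  obtain ⟨B, hB, hBb⟩ := exists_integrable_increment_bound h.pos h.one_div_lt h.lt_one t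
  refine mem_variableLp_of_integrable h.pos (fun x => (h.mem_Icc x).1)
    (measurable_temperedKernel H h.measurable lam t) hB.comp_neg fun x => ?_
  exact hBb lam (α x) (-x) hlam (h.mem_Icc x).1 (h.mem_Icc x).2

/-- The exponent of the characteristic function of a linear combination of rescaled increments. -/
lemma integral_rescaled_increments {H lam r : ℝ} {α : ℝ → ℝ} (hα : ∀ x, 0 < α x) (hr : 0 < r)
    (u : ℝ) {d : ℕ} (v θ : Fin d → ℝ) :
    ∫ x, |∑ k, θ k / r ^ H * (temperedKernel H α lam (u + r * v k) x
        - temperedKernel H α lam u x)| ^ α x =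
      ∫ z, |∑ k, θ k * (temperedPow (lam * r) (H - 1 / α (u - r * z)) (v k + z)
        - temperedPow (lam * r) (H - 1 / α (u - r * z)) z)| ^ α (u - r * z) := by
  set F : ℝ → ℝ := fun x => |∑ k, θ k / r ^ H * (temperedKernel H α lam (u + r * v k) x
        - temperedKernel H α lam u x)| ^ α x with hF
  have e1 : ∫ x, F x = r * ∫ z, F (u - r * z) := by
    rw [Measure.integral_comp_mul_left (fun y => F (u - y)) r, integral_sub_left_eq_self F _ u,
      abs_of_pos (by positivity), smul_eq_mul]
    field_simp
  rw [e1, ← integral_const_mul]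
  refine integral_congr_ae (ae_of_all _ fun z => ?_)
  simp only [hF]
  set A := α (u - r * z) with hA
  have hA0 : 0 < A := hα _
  -- The factor `r ^ (H - 1 / A)` from self-similarity, divided by `r ^ H`, leaves `r ^ (-1 / A)`,
  -- whose `A`-th power cancels the Jacobian `r`. The terms in `-x` drop out of the difference.
  have e2 : ∀ k, θ k / r ^ H * (temperedKernel H α lam (u + r * v k) (u - r * z)
        - temperedKernel H α lam u (u - r * z)) = r ^ (-1 / A) *
        (θ k * (temperedPow (lam * r) (H - 1 / A) (v k + z)
        - temperedPow (lam * r) (H - 1 / A) z)) := by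
    intro k
    rw [temperedKernel_eq, temperedKernel_eq, ← hA]
    have e3 : u + r * v k - (u - r * z) = r * (v k + z) := by ring
    have e4 : u - (u - r * z) = r * z := by ring
    rw [e3, e4, sub_sub_sub_cancel_right, temperedPow_mul _ _ _ hr, temperedPow_mul _ _ _ hr]
    have e5 : r ^ (-1 / A) = r ^ (H - 1 / A) / r ^ H := by
      rw [← Real.rpow_sub hr]; congr 1; ring
    rw [e5]; ring
  simp_rw [e2]
  rw [← Finset.mul_sum, abs_mul, Real.mul_rpow (abs_nonneg _) (abs_nonneg _),
    abs_of_pos (by positivity), ← Real.rpow_mul hr.le, div_mul_cancel₀ _ hA0.ne',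
    Real.rpow_neg_one, ← mul_assoc, mul_inv_cancel₀ hr.ne', one_mul]

lemma continuous_temperedPow_param (y : ℝ) :
    Continuous fun p : ℝ × ℝ => temperedPow p.1 p.2 y := by
  rcases le_or_gt y 0 with hy | hy
  · simp_rw [temperedPow_of_nonpos _ _ hy]; exact continuous_const
  · simp_rw [temperedPow_of_pos _ _ hy]
    exact Continuous.mul (by fun_prop) (Real.continuous_const_rpow hy.ne' |>.comp continuous_snd)

/-- Convergence of the exponents of the characteristic functions of the rescaled increments. -/
lemma Admissible.tendsto_exponent {a H lam : ℝ} {α : ℝ → ℝ} (h : Admissible a H α)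
    (hαc : Continuous α) (hlam : 0 ≤ lam) (u : ℝ) {d : ℕ} (v θ : Fin d → ℝ) :
    Tendsto (fun r : ℝ => ∫ z, |∑ k, θ k * (temperedPow (lam * r) (H - 1 / α (u - r * z)) (v k + z)
        - temperedPow (lam * r) (H - 1 / α (u - r * z)) z)| ^ α (u - r * z)) (𝓝[>] 0)
      (𝓝 (∫ z, |∑ k, θ k * (temperedPow 0 (H - 1 / α u) (v k + z)
        - temperedPow 0 (H - 1 / α u) z)| ^ α u)) := by
  have ha1 := one_lt_of_one_div_lt h.pos h.one_div_lt h.lt_one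
  choose B hB hBb using exists_integrable_increment_bound h.pos h.one_div_lt h.lt_one
  refine tendsto_integral_filter_of_dominated_convergence
    (fun z => d * ∑ k, max 1 |θ k| ^ (2 : ℝ) * B (v k) z) ?_ ?_ ?_ ?_
  · refine Eventually.of_forall fun r => Measurable.aestronglyMeasurable ?_
    have hαm : Measurable fun z => α (u - r * z) := h.measurable.comp (by fun_prop)
    refine Measurable.pow (Measurable.abs ?_) hαm
    refine Finset.measurable_sum _ fun k _ => Measurable.const_mul ?_ _
    exact (Measurable.temperedPow (by fun_prop) (by fun_prop) (by fun_prop)).sub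
      (Measurable.temperedPow (by fun_prop) (by fun_prop) (by fun_prop))
  · filter_upwards [self_mem_nhdsWithin] with r hr
    refine ae_of_all _ fun z => ?_
    have hA := h.mem_Icc (u - r * z)
    rw [Real.norm_of_nonneg (by positivity)]
    refine (abs_sum_rpow_le _ _ (ha1.le.trans hA.1) hA.2).trans ?_
    gcongr with k _
    exact hBb (v k) _ _ z (mul_nonneg hlam (le_of_lt hr)) hA.1 hA.2
  · exact (integrable_finsetSum _ fun k _ => (hB (v k)).const_mul _).const_mul _
  · refine ae_of_all _ fun z => ?_
    refine Tendsto.mono_left ?_ nhdsWithin_le_nhds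
    have hα0 : ContinuousAt (fun r : ℝ => α (u - r * z)) 0 := by fun_prop
    have hpow : ∀ y, ContinuousAt
        (fun r : ℝ => temperedPow (lam * r) (H - 1 / α (u - r * z)) y) 0 := by
      intro y
      refine ContinuousAt.comp (f := fun r : ℝ => (lam * r, H - 1 / α (u - r * z)))
        (continuous_temperedPow_param y).continuousAt ?_
      refine ContinuousAt.prodMk (by fun_prop) (continuousAt_const.sub ?_)
      refine continuousAt_const.div hα0 ?_
      exact (h.pos.trans_le (h.mem_Icc _).1).ne'
    have hsum : ContinuousAt (fun r : ℝ => |∑ k, θ k * (temperedPow (lam * r)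
        (H - 1 / α (u - r * z)) (v k + z)
        - temperedPow (lam * r) (H - 1 / α (u - r * z)) z)| ^ α (u - r * z)) 0 := by
      -- The base may vanish; continuity then rests on the positivity of the exponent.
      refine ContinuousAt.rpow (ContinuousAt.abs ?_) hα0
        (Or.inr (h.pos.trans_le (h.mem_Icc _).1))
      refine tendsto_finsetSum _ fun k _ => Tendsto.const_mul _ ?_
      exact (hpow (v k + z)).sub (hpow z)
    simpa [ContinuousAt] using hsum

/-! ### Increments of the linear tempered fractional multistable motion -/

section

variable {Ω : Type*} [MeasurableSpace Ω]

/-- The characteristic function of linear combinations of rescaled increments. -/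
lemma IsLTFmSM.charFun_rescaled_increments {a H lam : ℝ} {α : ℝ → ℝ} (h : Admissible a H α)
    (hlam : 0 ≤ lam) {P : Measure Ω} {X : ℝ → Ω → ℝ} (hX : IsLTFmSM H α lam X P) {r : ℝ}
    (hr : 0 < r) (u : ℝ) {d : ℕ} (v θ : Fin d → ℝ) :
    ∫ ω, Complex.exp (Complex.I *
        ((∑ k, θ k * ((X (u + r * v k) ω - X u ω) / r ^ H) : ℝ) : ℂ)) ∂P =
      ((Real.exp (-∫ z, |∑ k, θ k * (temperedPow (lam * r) (H - 1 / α (u - r * z)) (v k + z)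
        - temperedPow (lam * r) (H - 1 / α (u - r * z)) z)| ^ α (u - r * z)) : ℝ) : ℂ) := by
  -- The increments share the base point `u`, so they combine `d + 1` values of `X`, the one at `u`
  -- having minus the sum of the other coefficients.
  have hc := hX.charFun (d + 1) (Fin.cons u fun k => u + r * v k)
    (Fin.cons (-∑ k, θ k / r ^ H) fun k => θ k / r ^ H)
    (fun k => h.temperedKernel_mem_variableLp hlam _)
  rw [← integral_rescaled_increments (fun x => h.pos.trans_le (h.mem_Icc x).1) hr u v θ]
  have e1 : ∀ ω, ∑ k, (Fin.cons (-∑ k, θ k / r ^ H) (fun k => θ k / r ^ H) : Fin (d + 1) → ℝ) k *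
      X ((Fin.cons u fun k => u + r * v k : Fin (d + 1) → ℝ) k) ω =
      ∑ k, θ k * ((X (u + r * v k) ω - X u ω) / r ^ H) := by
    intro ω
    simp only [Fin.sum_univ_succ, Fin.cons_zero, Fin.cons_succ]
    rw [neg_mul, Finset.sum_mul, neg_add_eq_sub, ← Finset.sum_sub_distrib]
    refine Finset.sum_congr rfl fun k _ => ?_
    ring
  have e2 : ∀ x, ∑ k, (Fin.cons (-∑ k, θ k / r ^ H) (fun k => θ k / r ^ H) : Fin (d + 1) → ℝ) k *
      temperedKernel H α lam ((Fin.cons u fun k => u + r * v k : Fin (d + 1) → ℝ) k) x =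
      ∑ k, θ k / r ^ H * (temperedKernel H α lam (u + r * v k) x
        - temperedKernel H α lam u x) := by
    intro x
    simp only [Fin.sum_univ_succ, Fin.cons_zero, Fin.cons_succ]
    rw [neg_mul, Finset.sum_mul, neg_add_eq_sub, ← Finset.sum_sub_distrib]
    refine Finset.sum_congr rfl fun k _ => ?_
    ring
  simp_rw [e1, e2] at hc
  exact hc

/-- The constant in the bound on the increments. -/
def tailConst (a H : ℝ) : ℝ := 8 * (∫ z, incrementBound (a * (1 - H)) z) + 1

lemma tailConst_nonneg (a H : ℝ) : 0 ≤ tailConst a H := by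
  have : 0 ≤ ∫ z, incrementBound (a * (1 - H)) z := integral_nonneg (incrementBound_nonneg _)
  unfold tailConst
  linarith

/-- The tail at `x` is controlled by the mean of `1 - charFun` over `|ξ| ≤ 2 / x`, where `1 - exp
(-J) ≤ J`. -/
theorem IsLTFmSM.hasIncrementTail {a H lam : ℝ} {α : ℝ → ℝ} (h : Admissible a H α)
    (hlam : 0 ≤ lam) {P : Measure Ω} [IsProbabilityMeasure P] {X : ℝ → Ω → ℝ}
    (hX : IsLTFmSM H α lam X P) : HasIncrementTail (tailConst a H) H a X P := by
  intro s t x hst hx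
  set r := t - s with hr
  have hr0 : 0 < r := sub_pos.2 hst
  set ρ := r ^ H / x with hρ
  have hρ0 : 0 < ρ := by positivity
  set S := ∫ z, incrementBound (a * (1 - H)) z with hS
  have hS0 : 0 ≤ S := integral_nonneg (incrementBound_nonneg _)
  have hC : tailConst a H = 8 * S + 1 := rfl
  -- For `ρ > 1` the claim is trivial thanks to the `+ 1` in `tailConst`; `ρ ≤ 1` is needed later
  -- for `ρ ^ α ≤ ρ ^ a`.
  rcases lt_or_ge 1 ρ with h1 | h1
  · have : 1 ≤ ρ ^ a := Real.one_le_rpow h1.le h.pos.le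
    calc _ ≤ (1 : ℝ) := measureReal_le_one
      _ ≤ _ := by rw [hC]; nlinarith
  have hm : Measurable fun ω => X t ω - X s ω := (hX.measurable t).sub (hX.measurable s)
  have : IsProbabilityMeasure (P.map fun ω => X t ω - X s ω) :=
    Measure.isProbabilityMeasure_map hm.aemeasurable
  have hcf : ∀ ξ : ℝ, |ξ| ≤ 2 * x⁻¹ →
      ‖1 - charFun (P.map fun ω => X t ω - X s ω) ξ‖ ≤ 4 * ρ ^ a * S := by
    intro ξ hξ
    have hc := hX.charFun_rescaled_increments h hlam hr0 s (fun _ : Fin 1 => 1)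
      (fun _ : Fin 1 => ξ * r ^ H)
    simp only [Finset.univ_unique, Finset.sum_const, Finset.card_singleton, one_smul,
      mul_one] at hc
    set J := ∫ z, |ξ * r ^ H * (temperedPow (lam * r) (H - 1 / α (s - r * z)) (1 + z)
      - temperedPow (lam * r) (H - 1 / α (s - r * z)) z)| ^ α (s - r * z) with hJ
    have hchar : charFun (P.map fun ω => X t ω - X s ω) ξ = ((Real.exp (-J) : ℝ) : ℂ) := by
      rw [charFun_apply_real, integral_map hm.aemeasurable (by fun_prop), ← hc]
      refine integral_congr_ae (ae_of_all _ fun ω => ?_)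
      have e : s + r = t := by rw [hr]; ring
      have e' : ξ * r ^ H * ((X t ω - X s ω) / r ^ H) = ξ * (X t ω - X s ω) := by
        field_simp
      simp only [e, e']
      push_cast
      ring_nf
    have hξr : |ξ * r ^ H| ≤ 2 * ρ := by
      rw [abs_mul, abs_of_pos (by positivity : 0 < r ^ H), hρ]
      calc |ξ| * r ^ H ≤ 2 * x⁻¹ * r ^ H := by gcongr
        _ = _ := by ring
    have hJ0 : 0 ≤ J := integral_nonneg fun z => by positivity
    have hJS : J ≤ 4 * ρ ^ a * S := by
      rw [hJ, hS, ← integral_const_mul]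
      refine integral_mono_of_nonneg (ae_of_all _ fun z => by positivity)
        ((integrable_incrementBound (mul_pos h.pos (sub_pos.2 h.lt_one))).const_mul _)
        (ae_of_all _ fun z => ?_)
      obtain ⟨hA1, hA2⟩ := h.mem_Icc (s - r * z)
      have hA0 := h.pos.trans_le hA1
      simp only
      rw [abs_mul, Real.mul_rpow (abs_nonneg _) (abs_nonneg _)]
      refine mul_le_mul ?_ (abs_temperedPow_sub_rpow_le h.pos hA1 hA2 h.one_div_lt h.lt_one
        (by positivity) z) (by positivity) (by positivity)
      calc |ξ * r ^ H| ^ α (s - r * z) ≤ (2 * ρ) ^ α (s - r * z) :=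
            Real.rpow_le_rpow (abs_nonneg _) hξr hA0.le
        _ = 2 ^ α (s - r * z) * ρ ^ α (s - r * z) := Real.mul_rpow (by norm_num) hρ0.le
        _ ≤ 2 ^ (2 : ℝ) * ρ ^ a := by
            gcongr ?_ * ?_
            · exact Real.rpow_le_rpow_of_exponent_le (by norm_num) hA2
            · exact Real.rpow_le_rpow_of_exponent_ge hρ0 h1 hA1
        _ = 4 * ρ ^ a := by norm_num
    rw [hchar, ← Complex.ofReal_one, ← Complex.ofReal_sub, Complex.norm_real, Real.norm_eq_abs,
      abs_of_nonneg (by linarith [Real.exp_le_one_iff.2 (neg_nonpos.2 hJ0)])]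
    linarith [Real.add_one_le_exp (-J)]
  have hP : P.real {ω | x < |X t ω - X s ω|} =
      (P.map fun ω => X t ω - X s ω).real {y | x < |y|} := by
    have hset : MeasurableSet {y : ℝ | x < |y|} :=
      measurableSet_lt measurable_const measurable_norm
    rw [map_measureReal_apply hm hset]
    rfl
  rw [hP]
  refine (measureReal_abs_gt_le_integral_charFun hx).trans ?_
  have hint : ‖∫ ξ in (-2 * x⁻¹)..(2 * x⁻¹), 1 - charFun (P.map fun ω => X t ω - X s ω) ξ‖ ≤
      4 * ρ ^ a * S * |2 * x⁻¹ - -2 * x⁻¹| := by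
    refine intervalIntegral.norm_integral_le_of_norm_le_const fun ξ hξ => hcf ξ ?_
    have hx2 : -2 * x⁻¹ ≤ 2 * x⁻¹ := by
      have : 0 < x⁻¹ := by positivity
      linarith
    rw [Set.uIoc_of_le hx2] at hξ
    exact abs_le.2 ⟨by linarith [hξ.1], hξ.2⟩
  have habs : |2 * x⁻¹ - -2 * x⁻¹| = 4 * x⁻¹ := by
    rw [abs_of_nonneg (by have : 0 < x⁻¹ := by positivity
                          linarith)]
    ring
  rw [habs] at hint
  calc _ ≤ 2⁻¹ * x * (4 * ρ ^ a * S * (4 * x⁻¹)) := by gcongr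
    _ = 8 * S * ρ ^ a := by field_simp; ring
    _ ≤ _ := by
      rw [hC]
      have : 0 < ρ ^ a := by positivity
      linarith

/-! ### Linear fractional stable motion as the untempered case, and rescaling -/

lemma fractionalKernel_eq_temperedKernel (H A : ℝ) :
    fractionalKernel H A = temperedKernel H (fun _ => A) 0 := by
  ext t x
  simp [fractionalKernel, temperedKernel]

lemma IsLFSM.isLTFmSM {H A : ℝ} {Y : ℝ → Ω → ℝ} {P : Measure Ω} (hY : IsLFSM H A Y P) :
    IsLTFmSM H (fun _ => A) 0 Y P := by
  unfold IsLFSM at hY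
  rwa [fractionalKernel_eq_temperedKernel] at hY

/-- Linear fractional stable motion does not vanish almost surely at time `1`. -/
lemma IsLFSM.not_ae_eq_zero {a H A : ℝ} (h : Admissible a H fun _ => A) {Y : ℝ → Ω → ℝ}
    {P : Measure Ω} [IsProbabilityMeasure P] (hY : IsLFSM H A Y P) :
    ¬ ∀ᵐ ω ∂P, Y 1 ω = 0 := by
  intro h0
  have hA := h.mem_Icc 0
  have hA0 : 0 < A := h.pos.trans_le hA.1
  have hc := hY.isLTFmSM.charFun 1 (fun _ => 1) (fun _ => 1)
    (fun _ => h.temperedKernel_mem_variableLp le_rfl _)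
  simp only [Finset.univ_unique, Finset.sum_const, Finset.card_singleton, one_smul,
    one_mul] at hc
  have hl : ∫ ω, Complex.exp (Complex.I * ((Y 1 ω : ℝ) : ℂ)) ∂P = 1 := by
    have : ∫ ω, Complex.exp (Complex.I * ((Y 1 ω : ℝ) : ℂ)) ∂P = ∫ _, (1 : ℂ) ∂P := by
      refine integral_congr_ae ?_
      filter_upwards [h0] with ω hω
      simp [hω]
    rw [this]; simp
  rw [hl] at hc
  have hJ : ∫ x, |temperedKernel H (fun _ => A) 0 1 x| ^ A = 0 := by
    have := Complex.ofReal_eq_one.1 hc.symm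
    rw [Real.exp_eq_one_iff, neg_eq_zero] at this
    exact this
  obtain ⟨B, hB, hBb⟩ := exists_integrable_increment_bound h.pos h.one_div_lt h.lt_one 1
  have hint : Integrable fun x => |temperedKernel H (fun _ => A) 0 1 x| ^ A := by
    refine hB.comp_neg.mono'
      ((measurable_temperedKernel H measurable_const 0 1).abs.pow_const A).aestronglyMeasurable
      (ae_of_all _ fun x => ?_)
    rw [Real.norm_of_nonneg (by positivity)]
    exact hBb 0 A (-x) le_rfl hA.1 hA.2
  rw [integral_eq_zero_iff_of_nonneg (fun x => by positivity) hint] at hJ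
  -- On `(0, 1)` only the first term of the kernel survives and it is positive, so the integral
  -- cannot vanish.
  have hsub : Set.Ioo (0 : ℝ) 1 ⊆ {x | ¬ |temperedKernel H (fun _ => A) 0 1 x| ^ A = 0} := by
    intro x hx
    have e : temperedKernel H (fun _ => A) 0 1 x = (1 - x) ^ (H - 1 / A) := by
      rw [temperedKernel_eq, temperedPow_of_pos _ _ (by linarith [hx.2]),
        temperedPow_of_nonpos _ _ (by linarith [hx.1])]
      simp
    have : 0 < 1 - x := by linarith [hx.2]
    simp only [Set.mem_ofPred_eq, e]
    positivity
  have hz := measure_mono_null hsub (ae_iff.1 hJ)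
  simp at hz

lemma continuous_rescale (h u r : ℝ) : Continuous (rescale h u r) := by
  refine ContinuousMap.continuous_of_continuous_uncurry _ ?_
  simp only [Function.uncurry_def, rescale, ContinuousMap.coe_mk]
  have e : Continuous fun p : C(ℝ, ℝ) × ℝ => p.1 (u + r * p.2) :=
    continuous_fst.eval (by fun_prop)
  have e' : Continuous fun p : C(ℝ, ℝ) × ℝ => p.1 u := continuous_fst.eval continuous_const
  exact (e.sub e').div_const _

/-- The factor `r ^ H` gained from the time increment cancels the one in the normalisation, so `C`
is the same for every `r`. -/
lemma HasIncrementTail.rescale {C H a : ℝ} {X : Ω → C(ℝ, ℝ)} {P : Measure Ω}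
    (hX : HasIncrementTail C H a (fun t ω => X ω t) P) (u : ℝ) {r : ℝ} (hr : 0 < r) :
    HasIncrementTail C H a (fun t ω => Multistable.rescale H u r (X ω) t) P := by
  intro s t x hst hx
  have hrH : 0 < r ^ H := by positivity
  have h := hX (u + r * s) (u + r * t) (x * r ^ H) (by nlinarith) (by positivity)
  have e1 : u + r * t - (u + r * s) = r * (t - s) := by ring
  rw [e1, Real.mul_rpow hr.le (by linarith), mul_comm x, mul_div_mul_left _ _ hrH.ne'] at h
  convert h using 2
  ext ω
  simp only [Multistable.rescale, ContinuousMap.coe_mk, Set.mem_ofPred_eq]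
  rw [← sub_div, sub_sub_sub_cancel_right, abs_div, abs_of_pos hrH, lt_div_iff₀ hrH, mul_comm x]

end

end Multistable

end

/-! ### Strong localisability -/

theorem proposition20
    (a b : ℝ) (ha : 0 < a) (hab : a ≤ b) (hb : b ≤ 2)
    (α : ℝ → ℝ) (hα : ∀ x, α x ∈ Set.Icc a b) (hαc : Continuous α)
    (H lam : ℝ) (hH1 : 1 / a < H) (hH2 : H < 1) (hlam : 0 < lam) (u : ℝ)
    {Ω : Type*} [MeasurableSpace Ω] (P : Measure Ω) [IsProbabilityMeasure P]
    (X : ℝ → Ω → ℝ) (hX : Multistable.IsLTFmSM H α lam X P)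
    {Ω' : Type*} [MeasurableSpace Ω'] (Q : Measure Ω') [IsProbabilityMeasure Q]
    (Y : ℝ → Ω' → ℝ) (hY : Multistable.IsLFSM H (α u) Y Q) :
    Multistable.IsStronglyLocalisableAt H X P u Y Q := by
  have hadm : Multistable.Admissible a H α :=
    ⟨ha, hH1, hH2, fun x => ⟨(hα x).1, (hα x).2.trans hb⟩, hαc.measurable⟩
  -- The lower bound is kept at `a` rather than `α u`, so that `X` and `Y` obey the same increment
  -- bound.
  have hadmu : Multistable.Admissible a H fun _ => α u :=
    ⟨ha, hH1, hH2, fun _ => hadm.mem_Icc u, measurable_const⟩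
  have hH0 : 0 < H := lt_trans (by positivity) hH1
  have haH : 1 < a * H := by
    rw [div_lt_iff₀ ha] at hH1
    linarith
  have hC := Multistable.tailConst_nonneg a H
  have hXt := hX.hasIncrementTail hadm hlam.le
  have hYt := hY.isLTFmSM.hasIncrementTail hadmu le_rfl
  obtain ⟨X', hX'm, hX'⟩ := hXt.exists_isContinuousVersion hC hH0 ha haH hX.measurable
  obtain ⟨Y', hY'm, hY'⟩ := hYt.exists_isContinuousVersion hC hH0 ha haH hY.measurable
  refine ⟨hH0, ⟨1, hY.not_ae_eq_zero hadmu⟩, X', Y', ⟨hX'm, hX'⟩, ⟨hY'm, hY'⟩, ?_⟩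
  have hX't := hXt.congr (X' := fun t ω => X' ω t) hX'
  have hY't := hYt.congr (X' := fun t ω => Y' ω t) hY'
  refine Multistable.tendstoInDistribution_of_hasIncrementTail
    (fun r => (Multistable.continuous_rescale H u r).measurable.comp hX'm) hY'm hC hH0 ha haH ?_
    hY't fun d v θ => ?_
  · filter_upwards [self_mem_nhdsWithin] with r hr
    exact hX't.rescale u hr
  have hlimit : ∫ ω, Complex.exp (Complex.I * ((∑ k, θ k * Y' ω (v k) : ℝ) : ℂ)) ∂Q =
      ((Real.exp (-∫ z, |∑ k, θ k * (Multistable.temperedPow 0 (H - 1 / α u) (v k + z)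
        - Multistable.temperedPow 0 (H - 1 / α u) z)| ^ α u) : ℝ) : ℂ) := by
    have hc := hY.isLTFmSM.charFun d v θ
      (fun _ => hadmu.temperedKernel_mem_variableLp le_rfl _)
    -- Reflecting `x` matches the variable `z` of the rescaled exponents.
    rw [← integral_neg_eq_self (μ := volume)
      fun x => |∑ k, θ k * Multistable.temperedKernel H (fun _ => α u) 0 (v k) x| ^ α u] at hc
    simp only [Multistable.temperedKernel_eq, neg_neg, sub_neg_eq_add] at hc
    rw [← hc]
    refine integral_congr_ae ?_
    filter_upwards [ae_all_iff.2 fun k => hY' (v k)] with ω hω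
    simp only [hω]
  rw [hlimit]
  refine ((Complex.continuous_ofReal.comp (Real.continuous_exp.comp continuous_neg)).tendsto
    _ |>.comp (hadm.tendsto_exponent hαc hlam.le u v θ)).congr' ?_
  filter_upwards [self_mem_nhdsWithin] with r hr
  simp only [Function.comp]
  rw [← hX.charFun_rescaled_increments hadm hlam.le hr u v θ]
  refine integral_congr_ae ?_
  filter_upwards [ae_all_iff.2 fun k => hX' (u + r * v k), hX' u] with ω h1 h2
  simp only [Multistable.rescale, ContinuousMap.coe_mk, h1, h2]
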